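/- \textbf{Theorem (Fermionic Gaussian fidelity for 4-mode pure states).} Let $\mathcal H^n$ be the Hilbert space of $n$ fermionic modes with number basis $|x\rangle$, $x\in\{0,1\}^n$, vacuum $|0_F\rangle=|0\cdots0\rangle$, annihilation operators $a_j|x\rangle=(-1)^{x_1+\dots+x_{j-1}}x_j|x\oplus e_j\rangle$, Majorana operators $c_{2j-1}=a_j+a_j^\dagger$, $c_{2j}=i(a_j-a_j^\dagger)$ and parity operator $P=i^n c_1c_2\cdots c_{2n}$. Let $\mathcal H^n_+=\{\Psi: P\Psi=\Psi\}$. A unitary $U$ is Gaussian if there is $R\in O(2n)$ with $Uc_jU^\dagger=\sum_k R_{jk}c_k$ for all $j$. The (pure) Gaussian states are the vectors $e^{it}U|0_F\rangle$ with $t\in\mathbb R$ and $U$ a Gaussian unitary, and $\mathcal G_n^+$ is the set of those in $\mathcal H^n_+$. For a set $\mathcal D$ of states let $F_{\mathcal D}(\Psi)=\sup_{\phi\in\mathcal D}|\langle\phi,\Psi\rangle|^2$. Let $\theta$ be the antilinear map on $\mathcal H^4_+$ with $\theta|x\rangle=(-1)^{x_1+x_3}|\overline x\rangle$, where $\overline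 x$ is the bitwise complement of $x$. Let $\Psi\in\mathcal H^4_+$ be a unit vector. Then there are $f\in[1/2,1]$, $\varphi\in[0,2\pi)$ and $\Psi_g\in\mathcal G_4^+$ such that $\theta\Psi_g\in\mathcal G_4^+$, $\theta\Psi_g$ is orthogonal to $\Psi_g$, and $$\Psi=e^{i\varphi}\bigl(\sqrt f\,\Psi_g+\sqrt{1-f}\,\theta\Psi_g\bigr).$$ The weight $f=f(\Psi)$ is the same in every decomposition of this form with $f\in[1/2,1]$, $\varphi\in[0,2\pi)$ and $\Psi_g\in\mathcal G_4^+$. If $f>1/2$, the vector $e^{i\varphi}\Psi_g$ is also uniquely determined by $\Psi$, and if $1/2<f<1$, the pair $(e^{i\varphi},\Psi_g)$ is uniquely determined up to a simultaneous change of sign. Moreover, $$F_{\mathcal G_4^+}(\Psi)=f(\Psi).$$ -/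

import Mathlib

open scoped Matrix InnerProductSpace ComplexConjugate

noncomputable section

namespace Fermion

/-- The Hilbert space of `n` fermionic modes. The coordinate at the bit string `x` is the amplitude
of the number state `|x⟩`. -/
abbrev H (n : ℕ) : Type := EuclideanSpace ℂ (Fin n → Bool)

/-- Operators on `H n`, as matrices in the number basis. -/
abbrev Op (n : ℕ) : Type := Matrix (Fin n → Bool) (Fin n → Bool) ℂ

/-- The action of an operator on a vector. -/
abbrev Op.app {n : ℕ} (A : Op n) (Ψ : H n) : H n := Matrix.toEuclideanLin A Ψ

/-- The number state `|x⟩`. -/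
abbrev ket {n : ℕ} (x : Fin n → Bool) : H n := EuclideanSpace.single x 1

/-- The fermionic vacuum `|0_F⟩ = |0…0⟩`. -/
def vacuum (n : ℕ) : H n := ket fun _ => false

/-- `η_j(x) = ∑_{k < j} x_k`. -/
def eta {n : ℕ} (j : Fin n) (x : Fin n → Bool) : ℕ :=
  ∑ k ∈ Finset.univ.filter (fun k => k < j), (x k).toNat

/-- The annihilation operator: `a_j |x⟩ = (-1)^{η_j(x)} x_j |x ⊕ e_j⟩`. -/
def annihilation {n : ℕ} (j : Fin n) : Op n :=
  Matrix.of fun y x => if x j = true ∧ y = Function.update x j false then (-1) ^ eta j x else 0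

/-- The creation operator `a_j†`. -/
def creation {n : ℕ} (j : Fin n) : Op n := (annihilation j)ᴴ

/-- The Majorana operators, with indices counted from `0`:
`c_{2j} = a_j + a_j†` and `c_{2j+1} = i (a_j - a_j†)` for `0 ≤ j < n`. -/
def majorana {n : ℕ} (k : Fin (2 * n)) : Op n :=
  let j : Fin n := ⟨k.val / 2, by omega⟩
  if k.val % 2 = 0 then annihilation j + creation j
  else Complex.I • (annihilation j - creation j)

/-- The parity operator, `i^n` times the ordered product of all the `2n` Majorana operators. -/
def parity (n : ℕ) : Op n := Complex.I ^ n • (List.ofFn (majorana (n := n))).prod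

/-- The positive-parity subspace `{Ψ | P Ψ = Ψ}`. -/
def posParity (n : ℕ) : Set (H n) := {Ψ | (parity n).app Ψ = Ψ}

/-- A unitary `U` is Gaussian if `U c_j U† = ∑_k R_{jk} c_k` for a real orthogonal matrix `R`. -/
def IsGaussianUnitary {n : ℕ} (U : Op n) : Prop :=
  U ∈ Matrix.unitaryGroup (Fin n → Bool) ℂ ∧
    ∃ R ∈ Matrix.orthogonalGroup (Fin (2 * n)) ℝ,
      ∀ j, U * majorana j * Uᴴ = ∑ k, (R j k : ℂ) • majorana k

/-- The pure fermionic Gaussian states `e^{iθ} U |0_F⟩` with `U` a Gaussian unitary. -/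
def gaussianStates (n : ℕ) : Set (H n) :=
  {Ψ | ∃ (t : ℝ) (U : Op n), IsGaussianUnitary U ∧
    Ψ = Complex.exp (Complex.I * t) • U.app (vacuum n)}

/-- The positive-parity pure fermionic Gaussian states. -/
def posGaussianStates (n : ℕ) : Set (H n) := gaussianStates n ∩ posParity n

/-- The `D`-fidelity `sup_{φ ∈ D} |⟨φ, Ψ⟩|²`. -/
def fidelity {n : ℕ} (D : Set (H n)) (Ψ : H n) : ℝ :=
  sSup ((fun φ => ‖⟪φ, Ψ⟫_ℂ‖ ^ 2) '' D)

/-- The bitwise complement of a bit string. -/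
def flip {n : ℕ} (x : Fin n → Bool) : Fin n → Bool := fun j => !x j

/-- The antilinear map with `θ |x⟩ = (-1)^{x_1 + x_3} |x̄⟩` (bits counted from `1`), of which only
the restriction to positive-parity vectors is used. The amplitude of `θ Ψ` at `y` is
`(-1)^{x_1 + x_3}` times the conjugate of the amplitude of `Ψ` at `x = ȳ`. -/
def theta (Ψ : H 4) : H 4 :=
  WithLp.toLp 2 fun y =>
    (-1 : ℂ) ^ ((flip y 0).toNat + (flip y 2).toNat) * conj (Ψ (flip y))

/-- `Ψ = e^{iφ} (√f Ψ_g + √(1-f) θ Ψ_g)` with `Ψ_g` a positive-parity Gaussian state,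
`φ ∈ [0, 2π)` and `f ∈ [1/2, 1]`. -/
structure IsGaussianDecomposition (Ψ : H 4) (f φ : ℝ) (Ψg : H 4) : Prop where
  gaussian : Ψg ∈ posGaussianStates 4
  phase : φ ∈ Set.Ico 0 (2 * Real.pi)
  weight : f ∈ Set.Icc (1 / 2) 1
  eq : Ψ = Complex.exp (Complex.I * φ) •
    ((Real.sqrt f : ℂ) • Ψg + (Real.sqrt (1 - f) : ℂ) • theta Ψg)

end Fermion

end

/-! The antiunitary involution `theta` anticommutes with every Majorana operator, so it commutes
with real combinations of products of two of them. Hence B(Ψ, Φ) = ⟪θΨ, Φ⟫ is a symmetric bilinear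
form on the even subspace, invariant under the Gaussian unitaries built from such pairs. Everything
rests on one characterization: the even Gaussian states are exactly the even unit vectors with B(Ψ,
Ψ) = 0.

That Gaussian states are isotropic follows from `sum_majorana_app_mul`: ∑ c_k ⊗ c_k is invariant
under Gaussian conjugation and kills vacuum ⊗ vacuum, and one coordinate of this relation is the
quadric (`inner_theta_of_mem_posGaussianStates`). For the converse,
`mem_posGaussianStates_of_inner_theta` picks, by compactness, the vector of largest vacuum amplitude
in the orbit of Ψ. Stationarity under the rotations cos t + sin t c_p c_q removes its two-particle
amplitudes, and the quadric removes the four-particle one, so only the vacuum is left.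

The rest is geometry of B. After a change of phase B(Φ, Φ) = C lies in [0, 1]. If C < 1, the
relations Φ = √f g + √(1-f) θg and its `theta`-image can be solved for g, with 2√(f(1-f)) = C. If C
= 1, then Φ is `theta`-real, and g = (Φ + iv)/√2 for a `theta`-real unit vector v orthogonal to Φ.
Conversely |B(Ψ, Ψ)| = 2√(f(1-f)) recovers f, and the same linear system recovers e^{iφ} g when f >
1/2.

For the fidelity, let χ be Gaussian, a = ⟪g, χ⟫, b = ⟪θg, χ⟫. The residual r of χ off the span of g
and θg satisfies B(r, r) = -2ab, so Cauchy–Schwarz gives 2|a||b| ≤ 1 - |a|² - |b|², that is |a| +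
|b| ≤ 1. Therefore |⟪χ, Ψ⟫| ≤ √f |a| + √(1-f) |b| ≤ √f, with equality at χ = g. -/

noncomputable section

namespace Fermion

variable {n : ℕ}

/-! ### Majorana operators as signed bit flips -/

/-- The mode to which a Majorana operator belongs. -/
def mode (k : Fin (2 * n)) : Fin n := ⟨k.val / 2, by omega⟩

/-- Flip the bit at position `j`. -/
def toggle (j : Fin n) (y : Fin n → Bool) : Fin n → Bool := Function.update y j (!y j)

/-- The coefficient of `majorana k` in the row indexed by `y`. -/
def sgn (k : Fin (2 * n)) (y : Fin n → Bool) : ℂ :=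
  if k.val % 2 = 0 then (-1) ^ eta (mode k) y
  else Complex.I * (-1) ^ (y (mode k)).toNat * (-1) ^ eta (mode k) y

lemma toggle_self (j : Fin n) (y : Fin n → Bool) : toggle j y j = !y j := by
  simp [toggle]

lemma toggle_of_ne {i j : Fin n} (h : j ≠ i) (y : Fin n → Bool) : toggle i y j = y j := by
  simp [toggle, h]

lemma toggle_toggle (j : Fin n) (y : Fin n → Bool) : toggle j (toggle j y) = y := by
  simp [toggle]

lemma toggle_comm (i j : Fin n) (y : Fin n → Bool) :
    toggle i (toggle j y) = toggle j (toggle i y) := by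
  by_cases h : i = j
  · rw [h]
  · ext k
    by_cases hi : k = i <;> by_cases hj : k = j <;> simp_all [toggle]

lemma eq_toggle_comm {j : Fin n} {x y : Fin n → Bool} : x = toggle j y ↔ y = toggle j x := by
  constructor <;> (intro h; rw [h, toggle_toggle])

lemma neg_one_pow_eta_toggle (i j : Fin n) (y : Fin n → Bool) :
    (-1 : ℂ) ^ eta j (toggle i y) = (if i < j then -1 else 1) * (-1) ^ eta j y := by
  simp only [eta, ← Finset.prod_pow_eq_pow_sum]
  split_ifs with h
  · have hi : i ∈ Finset.univ.filter (fun k => k < j) := by simpa using h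
    rw [← Finset.mul_prod_erase _ _ hi, ← Finset.mul_prod_erase _ _ hi, ← mul_assoc]
    congr 1
    · rw [toggle_self]; cases y i <;> simp
    · refine Finset.prod_congr rfl fun k hk => ?_
      rw [toggle_of_ne (Finset.ne_of_mem_erase hk)]
  · rw [one_mul]
    refine Finset.prod_congr rfl fun k hk => ?_
    rw [toggle_of_ne]
    rintro rfl
    exact h (Finset.mem_filter.mp hk).2

lemma annihilation_apply (j : Fin n) (y x : Fin n → Bool) :
    annihilation j y x = if x = toggle j y ∧ y j = false then (-1) ^ eta j y else 0 := by
  have key : (x j = true ∧ y = Function.update x j false) ↔ (x = toggle j y ∧ y j = false) := by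
    constructor
    · rintro ⟨hx, rfl⟩
      refine ⟨?_, by simp⟩
      ext k
      by_cases hk : k = j <;> simp_all [toggle]
    · rintro ⟨rfl, hy⟩
      refine ⟨by simp [toggle_self, hy], ?_⟩
      ext k
      by_cases hk : k = j <;> simp_all [toggle]
  simp only [annihilation, Matrix.of_apply, key]
  split_ifs with h
  · rw [h.1, neg_one_pow_eta_toggle]; simp
  · rfl

lemma creation_apply (j : Fin n) (y x : Fin n → Bool) :
    creation j y x = if x = toggle j y ∧ y j = true then (-1) ^ eta j y else 0 := by
  have key : (y = toggle j x ∧ x j = false) ↔ (x = toggle j y ∧ y j = true) := by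
    rw [eq_toggle_comm]
    refine and_congr_right ?_
    rintro rfl
    simp [toggle_self]
  simp only [creation, Matrix.conjTranspose_apply, annihilation_apply, key]
  split_ifs with h
  · rw [h.1, neg_one_pow_eta_toggle]; simp
  · simp

/-- Annihilation acts in rows with an empty mode and creation in rows with a filled one, so their
supports are disjoint; the relative minus sign in the odd Majoranas becomes the factor `(-1) ^ (y
(mode k)).toNat`. -/
lemma majorana_apply (k : Fin (2 * n)) (y x : Fin n → Bool) :
    majorana k y x = if x = toggle (mode k) y then sgn k y else 0 := by
  have hm : (⟨k.val / 2, by omega⟩ : Fin n) = mode k := rfl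
  simp only [majorana, hm, sgn]
  split_ifs with h hx hx <;>
  · simp only [Matrix.smul_apply, Matrix.add_apply, Matrix.sub_apply, annihilation_apply,
      creation_apply, hx, smul_eq_mul]
    cases y (mode k) <;> simp

lemma app_apply (A : Op n) (Ψ : H n) (y : Fin n → Bool) : A.app Ψ y = ∑ x, A y x * Ψ x := by
  simp [Op.app, Matrix.toLpLin_apply, Matrix.mulVec, dotProduct]

lemma majorana_app (k : Fin (2 * n)) (Ψ : H n) (y : Fin n → Bool) :
    (majorana k).app Ψ y = sgn k y * Ψ (toggle (mode k) y) := by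
  simp [app_apply, majorana_apply]

lemma app_mul (A B : Op n) (Ψ : H n) : Op.app (A * B) Ψ = A.app (B.app Ψ) := by
  simp [Op.app, Matrix.toLpLin_apply]

lemma app_one (Ψ : H n) : Op.app (1 : Op n) Ψ = Ψ := by
  simp [Op.app]

lemma op_ext {A B : Op n} (h : ∀ Ψ, A.app Ψ = B.app Ψ) : A = B :=
  Matrix.toEuclideanLin.injective (LinearMap.ext h)

lemma app_sum {ι : Type*} (s : Finset ι) (A : ι → Op n) (Ψ : H n) :
    Op.app (∑ i ∈ s, A i) Ψ = ∑ i ∈ s, (A i).app Ψ := by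
  simp [Op.app, map_sum]

lemma app_smul_op (c : ℂ) (A : Op n) (Ψ : H n) : Op.app (c • A) Ψ = c • A.app Ψ := by
  simp [Op.app]

/-! ### The canonical anticommutation relations -/

lemma sgn_toggle_of_ne {k l : Fin (2 * n)} (h : mode k ≠ mode l) (y : Fin n → Bool) :
    sgn l (toggle (mode k) y) = (if mode k < mode l then -1 else 1) * sgn l y := by
  simp only [sgn, neg_one_pow_eta_toggle, toggle_of_ne h.symm]
  split_ifs <;> ring

lemma neg_one_pow_mul_self (m : ℕ) : (-1 : ℂ) ^ m * (-1) ^ m = 1 := by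
  rw [← pow_add, ← two_mul, pow_mul]; simp

lemma sgn_mul_sgn_toggle_of_eq {k l : Fin (2 * n)} (h : mode k = mode l) (hkl : k ≠ l)
    (y : Fin n → Bool) :
    sgn k y * sgn l (toggle (mode k) y) + sgn l y * sgn k (toggle (mode l) y) = 0 := by
  have h' : k.val / 2 = l.val / 2 := congrArg Fin.val h
  have hne : k.val ≠ l.val := fun e => hkl (Fin.ext e)
  simp only [sgn, h, neg_one_pow_eta_toggle, toggle_self]
  have h2 := neg_one_pow_mul_self (eta (mode l) y)
  rcases Nat.mod_two_eq_zero_or_one k with hk | hk <;>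
    rcases Nat.mod_two_eq_zero_or_one l with hl | hl
  · omega
  · simp only [hk, hl]; cases y (mode l) <;> simp <;> ring
  · simp only [hk, hl]; cases y (mode l) <;> simp <;> ring
  · omega

lemma sgn_mul_sgn_toggle_self (k : Fin (2 * n)) (y : Fin n → Bool) :
    sgn k y * sgn k (toggle (mode k) y) = 1 := by
  have h2 := neg_one_pow_mul_self (eta (mode k) y)
  simp only [sgn, neg_one_pow_eta_toggle, toggle_self, lt_irrefl, if_false]
  split_ifs
  · simpa using h2
  · cases y (mode k) <;> simp <;> linear_combination (-Complex.I * Complex.I) * h2 - Complex.I_mul_I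

lemma majorana_mul_self (k : Fin (2 * n)) : majorana k * majorana k = 1 := by
  refine op_ext fun Ψ => ?_
  ext y
  rw [app_mul, majorana_app, majorana_app, toggle_toggle, ← mul_assoc, sgn_mul_sgn_toggle_self,
    one_mul, app_one]

lemma majorana_anticomm {k l : Fin (2 * n)} (h : k ≠ l) :
    majorana k * majorana l = -(majorana l * majorana k) := by
  rw [eq_neg_iff_add_eq_zero]
  refine op_ext fun Ψ => ?_
  ext y
  have e : (Op.app (majorana k * majorana l + majorana l * majorana k) Ψ) y
      = (sgn k y * sgn l (toggle (mode k) y) + sgn l y * sgn k (toggle (mode l) y))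
        * Ψ (toggle (mode k) (toggle (mode l) y)) := by
    have : Op.app (majorana k * majorana l + majorana l * majorana k) Ψ
      = (majorana k).app ((majorana l).app Ψ) + (majorana l).app ((majorana k).app Ψ) := by
      rw [← app_mul, ← app_mul]; simp [Op.app]
    rw [this, PiLp.add_apply, majorana_app, majorana_app, majorana_app, majorana_app,
      toggle_comm (mode l)]
    ring
  rw [e]
  have z : (Op.app (0 : Op n) Ψ) y = 0 := by simp [Op.app]
  rw [z]
  by_cases hm : mode k = mode l
  · rw [sgn_mul_sgn_toggle_of_eq hm h, zero_mul]
  · rw [sgn_toggle_of_ne hm, sgn_toggle_of_ne (Ne.symm hm)]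
    rcases lt_or_gt_of_ne hm with hlt | hlt
    · simp [hlt, hlt.not_gt]; left; ring
    · simp [hlt, hlt.not_gt]; left; ring

lemma conjTranspose_majorana (k : Fin (2 * n)) : (majorana k)ᴴ = majorana k := by
  simp only [majorana, creation]
  split_ifs
  · simp [add_comm]
  · simp [← smul_neg]

/-! ### Gaussian unitaries -/

lemma IsGaussianUnitary.mul {U V : Op n} (hU : IsGaussianUnitary U) (hV : IsGaussianUnitary V) :
    IsGaussianUnitary (U * V) := by
  obtain ⟨hU, R, hR, h⟩ := hU
  obtain ⟨hV, S, hS, h'⟩ := hV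
  refine ⟨mul_mem hU hV, S * R, mul_mem hS hR, fun j => ?_⟩
  have : U * V * majorana j * (U * V)ᴴ = U * (V * majorana j * Vᴴ) * Uᴴ := by
    simp only [Matrix.conjTranspose_mul, mul_assoc]
  rw [this, h']
  simp only [Finset.mul_sum, Finset.sum_mul, Matrix.mul_smul, Matrix.smul_mul, h,
    Finset.smul_sum, smul_smul, Matrix.mul_apply, Complex.ofReal_sum, Complex.ofReal_mul,
    Finset.sum_smul]
  exact Finset.sum_comm

lemma orthogonal_sum_left {m : ℕ} {R : Matrix (Fin m) (Fin m) ℝ}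
    (hR : R ∈ Matrix.orthogonalGroup (Fin m) ℝ) (i j : Fin m) :
    ∑ k, (R k i : ℂ) * (R k j : ℂ) = if i = j then 1 else 0 := by
  have h := congrFun (congrFun ((Matrix.mem_orthogonalGroup_iff' (Fin m) ℝ).mp hR) i) j
  simp only [Matrix.mul_apply, Matrix.transpose_apply, Matrix.one_apply] at h
  have h' := congrArg Complex.ofReal h
  push_cast at h'
  split_ifs at h' ⊢ <;> simpa using h'

/-- Conjugation by the inverse of a Gaussian unitary. -/
lemma conj_star_majorana {U : Op n} (hU : U ∈ Matrix.unitaryGroup (Fin n → Bool) ℂ)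
    {R : Matrix (Fin (2 * n)) (Fin (2 * n)) ℝ} (hR : R ∈ Matrix.orthogonalGroup (Fin (2 * n)) ℝ)
    (h : ∀ j, U * majorana j * Uᴴ = ∑ k, (R j k : ℂ) • majorana k) (k : Fin (2 * n)) :
    Uᴴ * majorana k * U = ∑ j, (R j k : ℂ) • majorana j := by
  have h1 : Uᴴ * U = 1 := Matrix.mem_unitaryGroup_iff'.mp hU
  have e : majorana k = U * (∑ j, (R j k : ℂ) • majorana j) * Uᴴ := by
    simp only [Finset.mul_sum, Finset.sum_mul, Matrix.mul_smul, Matrix.smul_mul, h,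
      Finset.smul_sum, smul_smul]
    rw [Finset.sum_comm]
    simp only [← Finset.sum_smul, orthogonal_sum_left hR]
    simp
  conv_lhs => rw [e]
  rw [mul_assoc, mul_assoc, h1, mul_one, ← mul_assoc, h1, one_mul]

lemma IsGaussianUnitary.conjTranspose {U : Op n} (hU : IsGaussianUnitary U) :
    IsGaussianUnitary Uᴴ := by
  obtain ⟨hU, R, hR, h⟩ := hU
  refine ⟨Unitary.star_mem hU, Rᵀ, ?_, fun j => ?_⟩
  · have := Unitary.star_mem hR
    rwa [Matrix.star_eq_conjTranspose, Matrix.conjTranspose_eq_transpose_of_trivial] at this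
  · rw [Matrix.conjTranspose_conjTranspose, conj_star_majorana hU hR h]
    rfl

/-- The Majorana operator `∑ k, w k • c_k` of a real vector. -/
def cliff (w : Fin (2 * n) → ℝ) : Op n := ∑ k, (w k : ℂ) • majorana k

lemma cliff_mul_majorana (w : Fin (2 * n) → ℝ) (j : Fin (2 * n)) :
    cliff w * majorana j = (2 * w j : ℂ) • (1 : Op n) - majorana j * cliff w := by
  have key : ∀ k, majorana k * majorana j
      = (if k = j then (2 : ℂ) • (1 : Op n) else 0) - majorana j * majorana k := by
    intro k
    split_ifs with h
    · rw [h, majorana_mul_self, two_smul]; simp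
    · rw [majorana_anticomm h]; simp
  simp only [cliff, Finset.sum_mul, Finset.mul_sum, Matrix.smul_mul, Matrix.mul_smul, key,
    smul_sub, Finset.sum_sub_distrib]
  congr 1
  simp [smul_smul, mul_comm]

/-- Anticommuting one factor past the other shows that the square X satisfies X = 2 - X. -/
lemma cliff_mul_cliff_self {w : Fin (2 * n) → ℝ} (hw : ∑ k, w k ^ 2 = 1) :
    cliff w * cliff w = 1 := by
  have h : cliff w * cliff w = (2 : ℂ) • (1 : Op n) - cliff w * cliff w := by
    conv_lhs => enter [2]; rw [cliff]
    simp only [Finset.mul_sum, Matrix.mul_smul, cliff_mul_majorana, smul_sub,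
      Finset.sum_sub_distrib, smul_smul, ← Finset.sum_smul]
    congr 1
    · congr 1
      have : ((∑ k, w k ^ 2 : ℝ) : ℂ) = 1 := by rw [hw]; simp
      push_cast at this
      calc ∑ k, (w k : ℂ) * (2 * w k) = 2 * ∑ k, (w k : ℂ) ^ 2 := by
            rw [Finset.mul_sum]; exact Finset.sum_congr rfl fun k _ => by ring
        _ = 2 := by rw [this, mul_one]
    · conv_rhs => enter [1]; rw [cliff]
      simp [Finset.sum_mul]
  have h2 : (2 : ℂ) • (cliff w * cliff w) = (2 : ℂ) • (1 : Op n) := by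
    rw [two_smul]; nth_rewrite 1 [h]; simp
  exact (smul_right_injective _ (two_ne_zero' ℂ)) h2

lemma conjTranspose_cliff (w : Fin (2 * n) → ℝ) : (cliff w)ᴴ = cliff w := by
  simp [cliff, Matrix.conjTranspose_sum, Matrix.conjTranspose_smul, conjTranspose_majorana]

/-- Conjugation acts on the Majorana vectors by 2wwᵀ - 1, minus the reflection in the hyperplane
orthogonal to w. -/
lemma isGaussianUnitary_cliff {w : Fin (2 * n) → ℝ} (hw : ∑ k, w k ^ 2 = 1) :
    IsGaussianUnitary (cliff w) := by
  have h1 := cliff_mul_cliff_self hw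
  refine ⟨?_, Matrix.of fun j k => 2 * w j * w k - if j = k then 1 else 0, ?_, fun j => ?_⟩
  · rw [Matrix.mem_unitaryGroup_iff, Matrix.star_eq_conjTranspose, conjTranspose_cliff, h1]
  · rw [Matrix.mem_orthogonalGroup_iff]
    ext i j
    simp only [Matrix.mul_apply, Matrix.transpose_apply, Matrix.of_apply]
    have : ∀ k, (2 * w i * w k - if i = k then (1 : ℝ) else 0) *
        (2 * w j * w k - if j = k then 1 else 0) = 4 * w i * w j * w k ^ 2
        - (if i = k then 2 * w j * w k else 0) - (if j = k then 2 * w i * w k else 0)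
        + if i = k then (if j = k then 1 else 0) else 0 := by
      intro k; split_ifs <;> ring
    simp only [this, Finset.sum_add_distrib, Finset.sum_sub_distrib, ← Finset.mul_sum, hw]
    simp [Matrix.one_apply, eq_comm]
    ring
  · rw [conjTranspose_cliff, cliff_mul_majorana, sub_mul, mul_assoc, h1]
    simp only [Matrix.of_apply, Complex.ofReal_sub, Complex.ofReal_mul, sub_smul,
      Finset.sum_sub_distrib, mul_one]
    congr 1
    · rw [smul_mul_assoc, one_mul, cliff, Finset.smul_sum]
      exact Finset.sum_congr rfl fun k _ => by rw [smul_smul]; norm_cast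
    · simp

/-! ### Four modes: parity and the antiunitary `theta` -/

lemma eta_four (j : Fin 4) (x : Fin 4 → Bool) :
    eta j x = (if 0 < j then (x 0).toNat else 0) + (if 1 < j then (x 1).toNat else 0)
      + (if 2 < j then (x 2).toNat else 0) := by
  have h3 : ¬ (3 : Fin 4) < j := by omega
  simp [eta, Finset.sum_filter, Fin.sum_univ_four, h3]

/-- The sign `(-1)^|y|`. -/
def wt (y : Fin 4 → Bool) : ℂ :=
  (-1) ^ ((y 0).toNat + (y 1).toNat + (y 2).toNat + (y 3).toNat)

/-- The two Majoranas of one mode multiply to a diagonal operator; four such factors give the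
diagonal form of the parity, since (-i)⁴ = 1. -/
lemma pair_app (k l : Fin (2 * 4)) (hk : k.val % 2 = 0) (hl : l.val = k.val + 1)
    (Ψ : H 4) (y : Fin 4 → Bool) :
    (majorana k).app ((majorana l).app Ψ) y
      = -Complex.I * (-1) ^ (y (mode k)).toNat * Ψ y := by
  have hm : mode l = mode k := Fin.ext (by simp only [mode]; omega)
  have hl' : l.val % 2 ≠ 0 := by omega
  have h2 := neg_one_pow_mul_self (eta (mode k) y)
  rw [majorana_app, majorana_app, hm, toggle_toggle]
  simp only [sgn, hk, hm, if_true, if_neg hl', neg_one_pow_eta_toggle, toggle_self, lt_irrefl,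
    if_false]
  cases y (mode k) <;> simp <;> linear_combination (Complex.I * Ψ y) * h2

lemma parity_app (Ψ : H 4) (y : Fin 4 → Bool) : (parity 4).app Ψ y = wt y * Ψ y := by
  have e : parity 4 = majorana 0 * (majorana 1 * (majorana 2 * (majorana 3 * (majorana 4 *
      (majorana 5 * (majorana 6 * majorana 7)))))) := by
    rw [parity, Complex.I_pow_four, one_smul]
    simp [List.ofFn_succ]
  rw [e]
  simp only [app_mul]
  rw [pair_app 0 1 rfl rfl, pair_app 2 3 rfl rfl, pair_app 4 5 rfl rfl, pair_app 6 7 rfl rfl]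
  simp only [wt, pow_add]
  have m0 : mode (0 : Fin (2 * 4)) = 0 := rfl
  have m2 : mode (2 : Fin (2 * 4)) = 1 := rfl
  have m4 : mode (4 : Fin (2 * 4)) = 2 := rfl
  have m6 : mode (6 : Fin (2 * 4)) = 3 := rfl
  rw [m0, m2, m4, m6]
  linear_combination ((-1) ^ (y 0).toNat * (-1) ^ (y 1).toNat * (-1) ^ (y 2).toNat *
    (-1) ^ (y 3).toNat * Ψ y) * Complex.I_pow_four

lemma wt_toggle (j : Fin 4) (y : Fin 4 → Bool) : wt (toggle j y) = -wt y := by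
  fin_cases j <;> simp only [wt, toggle, pow_add] <;> simp [Function.update] <;>
    [cases y 0; cases y 1; cases y 2; cases y 3] <;> simp

lemma wt_flip (y : Fin 4 → Bool) : wt (flip y) = wt y := by
  simp only [wt, flip, pow_add]
  cases y 0 <;> cases y 1 <;> cases y 2 <;> cases y 3 <;> simp

lemma mem_posParity_iff {Ψ : H 4} : Ψ ∈ posParity 4 ↔ ∀ y, wt y = -1 → Ψ y = 0 := by
  have h1 : Ψ ∈ posParity 4 ↔ ∀ y, wt y * Ψ y = Ψ y := by
    constructor
    · intro h y
      rw [← parity_app, (h : (parity 4).app Ψ = Ψ)]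
    · intro h
      change (parity 4).app Ψ = Ψ
      ext y
      rw [parity_app, h]
  rw [h1]
  refine forall_congr' fun y => ?_
  have hw : wt y = 1 ∨ wt y = -1 := neg_one_pow_eq_or ℂ _
  rcases hw with h | h
  · simp [h]; norm_num
  · simp [h, neg_eq_self]

lemma parity_mul_majorana (k : Fin (2 * 4)) :
    parity 4 * majorana k = -(majorana k * parity 4) := by
  rw [eq_neg_iff_add_eq_zero]
  refine op_ext fun Ψ => ?_
  ext y
  have : Op.app (parity 4 * majorana k + majorana k * parity 4) Ψ
      = (parity 4).app ((majorana k).app Ψ) + (majorana k).app ((parity 4).app Ψ) := by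
    rw [← app_mul, ← app_mul]; simp [Op.app]
  rw [this, PiLp.add_apply, parity_app, majorana_app, majorana_app, parity_app, wt_toggle]
  simp [Op.app]
  ring

lemma parity_mul_cliff (w : Fin (2 * 4) → ℝ) : parity 4 * cliff w = -(cliff w * parity 4) := by
  simp [cliff, Finset.mul_sum, Finset.sum_mul, parity_mul_majorana, -Complex.coe_smul]

/-- The sign in the definition of `theta`. -/
def thetaSign (y : Fin 4 → Bool) : ℂ := (-1) ^ ((flip y 0).toNat + (flip y 2).toNat)

lemma theta_apply (Ψ : H 4) (y : Fin 4 → Bool) :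
    theta Ψ y = thetaSign y * conj (Ψ (flip y)) := rfl

lemma flip_flip (y : Fin 4 → Bool) : flip (flip y) = y := by
  ext j; simp [flip]

lemma conj_thetaSign (y : Fin 4 → Bool) : conj (thetaSign y) = thetaSign y := by
  simp [thetaSign]

lemma thetaSign_flip (y : Fin 4 → Bool) : thetaSign (flip y) = thetaSign y := by
  simp only [thetaSign, flip, pow_add]
  cases y 0 <;> cases y 2 <;> simp

lemma thetaSign_mul_self (y : Fin 4 → Bool) : thetaSign y * thetaSign y = 1 :=
  neg_one_pow_mul_self _

lemma theta_add (Ψ Φ : H 4) : theta (Ψ + Φ) = theta Ψ + theta Φ := by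
  ext y; simp [theta_apply, mul_add]

lemma theta_sub (Ψ Φ : H 4) : theta (Ψ - Φ) = theta Ψ - theta Φ := by
  ext y; simp [theta_apply, mul_sub]

lemma theta_smul (c : ℂ) (Ψ : H 4) : theta (c • Ψ) = conj c • theta Ψ := by
  ext y; simp [theta_apply]; ring

lemma theta_theta (Ψ : H 4) : theta (theta Ψ) = Ψ := by
  ext y
  simp only [theta_apply, map_mul, Complex.conj_conj, conj_thetaSign, thetaSign_flip, flip_flip]
  rw [← mul_assoc, thetaSign_mul_self, one_mul]

lemma inner_theta_theta (Ψ Φ : H 4) : ⟪theta Ψ, theta Φ⟫_ℂ = ⟪Φ, Ψ⟫_ℂ := by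
  simp only [PiLp.inner_apply, theta_apply]
  refine Fintype.sum_bijective flip (Function.Involutive.bijective flip_flip) _ _ fun y => ?_
  simp only [RCLike.inner_apply, map_mul, Complex.conj_conj, conj_thetaSign]
  linear_combination (conj (Φ (flip y)) * Ψ (flip y)) * thetaSign_mul_self y

lemma norm_theta (Ψ : H 4) : ‖theta Ψ‖ = ‖Ψ‖ := by
  rw [@norm_eq_sqrt_re_inner ℂ, @norm_eq_sqrt_re_inner ℂ, inner_theta_theta]

lemma theta_mem_posParity {Ψ : H 4} (h : Ψ ∈ posParity 4) : theta Ψ ∈ posParity 4 := by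
  rw [mem_posParity_iff] at h ⊢
  intro y hy
  rw [theta_apply, h _ (by rw [wt_flip, hy])]
  simp

lemma flip_toggle (j : Fin 4) (y : Fin 4 → Bool) : flip (toggle j y) = toggle j (flip y) := by
  ext k
  by_cases h : k = j <;> simp_all [flip, toggle]

/-- The sign in `theta` serves this identity, which makes `theta` anticommute with all Majorana
operators. -/
lemma sgn_theta (k : Fin (2 * 4)) (y : Fin 4 → Bool) :
    thetaSign y * conj (sgn k (flip y)) = -(sgn k y * thetaSign (toggle (mode k) y)) := by
  simp only [sgn, thetaSign, eta_four, flip, pow_add, toggle]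
  fin_cases k <;> simp [mode, Function.update] <;>
    cases y 0 <;> cases y 1 <;> cases y 2 <;> cases y 3 <;> simp

lemma theta_majorana (k : Fin (2 * 4)) (Ψ : H 4) :
    theta ((majorana k).app Ψ) = -(majorana k).app (theta Ψ) := by
  ext y
  rw [theta_apply, majorana_app, map_mul, PiLp.neg_apply, majorana_app, theta_apply, flip_toggle,
    ← mul_assoc, ← mul_assoc, sgn_theta, neg_mul]

lemma theta_sum {ι : Type*} (s : Finset ι) (f : ι → H 4) :
    theta (∑ i ∈ s, f i) = ∑ i ∈ s, theta (f i) := by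
  classical
  induction s using Finset.induction_on with
  | empty => ext y; simp [theta_apply]
  | insert a s ha ih => rw [Finset.sum_insert ha, Finset.sum_insert ha, theta_add, ih]

lemma theta_cliff (w : Fin (2 * 4) → ℝ) (Ψ : H 4) :
    theta ((cliff w).app Ψ) = -(cliff w).app (theta Ψ) := by
  simp only [cliff, app_sum, app_smul_op, theta_sum, theta_smul, theta_majorana, Complex.conj_ofReal,
    smul_neg, Finset.sum_neg_distrib]

lemma continuous_theta : Continuous theta := by
  unfold theta
  fun_prop

/-! ### Gaussian states are the even unit vectors orthogonal to their `theta`-images -/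

lemma app_conjTranspose_app {n : ℕ} {U : Op n} (hU : U ∈ Matrix.unitaryGroup (Fin n → Bool) ℂ)
    (Ψ : H n) : Op.app Uᴴ (U.app Ψ) = Ψ := by
  rw [← app_mul, ← Matrix.star_eq_conjTranspose, Matrix.mem_unitaryGroup_iff'.mp hU, app_one]

lemma inner_app_app {n : ℕ} {U : Op n} (hU : U ∈ Matrix.unitaryGroup (Fin n → Bool) ℂ)
    (Ψ Φ : H n) : ⟪U.app Ψ, U.app Φ⟫_ℂ = ⟪Ψ, Φ⟫_ℂ := by
  have h : ⟪U.app Ψ, U.app Φ⟫_ℂ = ⟪Ψ, Op.app Uᴴ (U.app Φ)⟫_ℂ := by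
    simp only [Op.app]
    rw [Matrix.toEuclideanLin_conjTranspose_eq_adjoint, LinearMap.adjoint_inner_right]
  rw [h, app_conjTranspose_app hU]

lemma norm_app {n : ℕ} {U : Op n} (hU : U ∈ Matrix.unitaryGroup (Fin n → Bool) ℂ) (Ψ : H n) :
    ‖U.app Ψ‖ = ‖Ψ‖ := by
  rw [@norm_eq_sqrt_re_inner ℂ, @norm_eq_sqrt_re_inner ℂ, inner_app_app hU]

lemma norm_of_mem_gaussianStates {n : ℕ} {Ψ : H n} (h : Ψ ∈ gaussianStates n) : ‖Ψ‖ = 1 := by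
  obtain ⟨t, U, hU, rfl⟩ := h
  rw [norm_smul, norm_app hU.1, mul_comm Complex.I, Complex.norm_exp_ofReal_mul_I]
  simp [vacuum, ket]

/-! ### Four-mode coordinates and the quadric containing the Gaussian states. -/

lemma vec_eta (y : Fin 4 → Bool) : y = ![y 0, y 1, y 2, y 3] := by
  ext j; fin_cases j <;> rfl

/-- Bit strings of length four as quadruples. -/
def quadEquiv : Bool × Bool × Bool × Bool ≃ (Fin 4 → Bool) where
  toFun p := ![p.1, p.2.1, p.2.2.1, p.2.2.2]
  invFun y := (y 0, y 1, y 2, y 3)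
  left_inv _ := rfl
  right_inv y := (vec_eta y).symm

lemma sum_bits (f : (Fin 4 → Bool) → ℂ) :
    ∑ y, f y = ∑ a, ∑ b, ∑ c, ∑ d, f ![a, b, c, d] := by
  rw [← quadEquiv.sum_comp]
  simp only [Fintype.sum_prod_type]
  rfl

lemma flip_vec (a b c d : Bool) : flip ![a, b, c, d] = ![!a, !b, !c, !d] := by
  ext j; fin_cases j <;> rfl

lemma toggle_vec_zero (a b c d : Bool) : toggle 0 ![a, b, c, d] = ![!a, b, c, d] := by
  ext j; fin_cases j <;> rfl

lemma toggle_vec_one (a b c d : Bool) : toggle 1 ![a, b, c, d] = ![a, !b, c, d] := by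
  ext j; fin_cases j <;> rfl

lemma toggle_vec_two (a b c d : Bool) : toggle 2 ![a, b, c, d] = ![a, b, !c, d] := by
  ext j; fin_cases j <;> rfl

lemma toggle_vec_three (a b c d : Bool) : toggle 3 ![a, b, c, d] = ![a, b, c, !d] := by
  ext j; fin_cases j <;> rfl

lemma wt_vec (a b c d : Bool) :
    wt ![a, b, c, d] = (-1) ^ (a.toNat + b.toNat + c.toNat + d.toNat) := rfl

lemma thetaSign_vec (a b c d : Bool) :
    thetaSign ![a, b, c, d] = (-1) ^ ((!a).toNat + (!c).toNat) := rfl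

/-- On even vectors, `⟪θ Ψ, Ψ⟫` is the quadratic form of the four-mode Pfaffian relation. -/
lemma inner_theta_self {Ψ : H 4} (h : Ψ ∈ posParity 4) :
    ⟪theta Ψ, Ψ⟫_ℂ = 2 * (Ψ ![false, false, false, false] * Ψ ![true, true, true, true]
      - Ψ ![true, true, false, false] * Ψ ![false, false, true, true]
      + Ψ ![true, false, true, false] * Ψ ![false, true, false, true]
      - Ψ ![true, false, false, true] * Ψ ![false, true, true, false]) := by
  rw [mem_posParity_iff] at h
  have h0 : ∀ a b c d : Bool, wt ![a, b, c, d] = -1 → Ψ ![a, b, c, d] = 0 :=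
    fun a b c d => h _
  have h1 := h0 true false false false (by rw [wt_vec]; norm_num)
  have h2 := h0 false true false false (by rw [wt_vec]; norm_num)
  have h3 := h0 false false true false (by rw [wt_vec]; norm_num)
  have h4 := h0 false false false true (by rw [wt_vec]; norm_num)
  simp only [PiLp.inner_apply, sum_bits, RCLike.inner_apply, theta_apply, map_mul,
    Complex.conj_conj, conj_thetaSign, thetaSign_vec, flip_vec, Fintype.sum_bool]
  simp [h1, h2, h3, h4]
  ring

/-- This is a_j |0⟩ = 0 written with the Majorana operators of mode j. -/
lemma majorana_vacuum_pair {n : ℕ} (k l : Fin (2 * n)) (hk : k.val % 2 = 0)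
    (hl : l.val = k.val + 1) :
    (majorana l).app (vacuum n) = -Complex.I • (majorana k).app (vacuum n) := by
  have hm : mode l = mode k := Fin.ext (by simp only [mode]; omega)
  have hl' : l.val % 2 ≠ 0 := by omega
  ext y
  rw [PiLp.smul_apply, majorana_app, majorana_app, hm]
  by_cases hy : toggle (mode k) y = fun _ => false
  · have hb : y (mode k) = true := by
      have := congrFun hy (mode k)
      simpa [toggle_self] using this
    simp [sgn, hk, hm, hl', hb, mul_assoc]
  · simp [vacuum, ket, hy]

/-- A Gaussian state is annihilated by `∑ k, c_k ⊗ c_k`. -/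
lemma sum_majorana_app_mul {Ψ : H 4} (h : Ψ ∈ gaussianStates 4) (x y : Fin 4 → Bool) :
    ∑ k, (majorana k).app Ψ x * (majorana k).app Ψ y = 0 := by
  obtain ⟨t, U, ⟨hU, R, hR, hUR⟩, rfl⟩ := h
  set v : Fin (2 * 4) → H 4 := fun j => U.app ((majorana j).app (vacuum 4)) with hv
  have e : ∀ k, (majorana k).app (U.app (vacuum 4)) = ∑ j, (R j k : ℂ) • v j := by
    intro k
    have h1 : majorana k * U = U * ∑ j, (R j k : ℂ) • majorana j := by
      rw [← conj_star_majorana hU hR hUR, ← mul_assoc, ← mul_assoc,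
        ← Matrix.star_eq_conjTranspose, Matrix.mem_unitaryGroup_iff.mp hU, one_mul]
    rw [← app_mul, h1, app_mul, app_sum]
    simp only [app_smul_op]
    simp [hv, Op.app, -Complex.coe_smul]
  have hR' : ∀ i j, ∑ k, (R i k : ℂ) * (R j k : ℂ) = if i = j then 1 else 0 := by
    have ht : Rᵀ ∈ Matrix.orthogonalGroup (Fin (2 * 4)) ℝ := by
      have := Unitary.star_mem hR
      rwa [Matrix.star_eq_conjTranspose, Matrix.conjTranspose_eq_transpose_of_trivial] at this
    exact fun i j => orthogonal_sum_left ht i j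
  -- Orthogonality of R makes the sum over k insensitive to U, reducing the claim to the vacuum.
  have hsum : ∑ k, (majorana k).app (U.app (vacuum 4)) x * (majorana k).app (U.app (vacuum 4)) y
      = ∑ j, v j x * v j y := by
    have e' : ∀ k z, (majorana k).app (U.app (vacuum 4)) z = ∑ j, (R j k : ℂ) * v j z := by
      intro k z
      rw [e]
      simp [-Complex.coe_smul]
    simp only [e', Finset.sum_mul_sum]
    rw [Finset.sum_comm]
    refine Finset.sum_congr rfl fun i _ => ?_
    rw [Finset.sum_comm]
    have : ∀ j, ∑ k, (R i k : ℂ) * v i x * ((R j k : ℂ) * v j y)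
        = (if i = j then 1 else 0) * (v i x * v j y) := by
      intro j
      rw [← hR', Finset.sum_mul]
      exact Finset.sum_congr rfl fun k _ => by ring
    simp only [this]
    simp
  have hpair : ∀ (k l : Fin (2 * 4)), k.val % 2 = 0 → l.val = k.val + 1 → ∀ z,
      v l z = -Complex.I * v k z := by
    intro k l hk hl z
    simp only [hv]
    rw [majorana_vacuum_pair k l hk hl]
    simp [Op.app]
  have hzero : ∑ j, v j x * v j y = 0 := by
    rw [show (∑ j, v j x * v j y) = ∑ j : Fin 8, v j x * v j y from rfl, Fin.sum_univ_eight]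
    rw [hpair 0 1 rfl rfl, hpair 2 3 rfl rfl, hpair 4 5 rfl rfl, hpair 6 7 rfl rfl,
      hpair 0 1 rfl rfl, hpair 2 3 rfl rfl, hpair 4 5 rfl rfl, hpair 6 7 rfl rfl]
    linear_combination (v 0 x * v 0 y + v 2 x * v 2 y + v 4 x * v 4 y + v 6 x * v 6 y)
      * Complex.I_mul_I
  have hs : ∀ k z, (majorana k).app (Complex.exp (Complex.I * t) • U.app (vacuum 4)) z
      = Complex.exp (Complex.I * t) * (majorana k).app (U.app (vacuum 4)) z := by
    intro k z; simp [Op.app]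
  simp only [hs]
  have : ∀ k, Complex.exp (Complex.I * t) * (majorana k).app (U.app (vacuum 4)) x *
      (Complex.exp (Complex.I * t) * (majorana k).app (U.app (vacuum 4)) y)
      = Complex.exp (Complex.I * t) ^ 2 * ((majorana k).app (U.app (vacuum 4)) x *
        (majorana k).app (U.app (vacuum 4)) y) := fun k => by ring
  rw [Finset.sum_congr rfl fun k _ => this k, ← Finset.mul_sum, hsum, hzero, mul_zero]

lemma inner_theta_of_mem_posGaussianStates {Ψ : H 4} (h : Ψ ∈ posGaussianStates 4) :
    ⟪theta Ψ, Ψ⟫_ℂ = 0 := by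
  -- Flipping the same bit in these complementary odd strings yields exactly the four complementary
  -- even pairs of the quadric; the two Majoranas of each mode contribute equally, whence the factor
  -- 2.
  have hs := sum_majorana_app_mul h.1 ![true, false, false, false] ![false, true, true, true]
  rw [inner_theta_self h.2]
  rw [← hs, show (∑ k : Fin (2 * 4), (majorana k).app Ψ ![true, false, false, false] *
    (majorana k).app Ψ ![false, true, true, true]) = ∑ k : Fin 8,
    (majorana (n := 4) k).app Ψ ![true, false, false, false] *
    (majorana (n := 4) k).app Ψ ![false, true, true, true] from rfl, Fin.sum_univ_eight]
  have m0 : mode (0 : Fin (2 * 4)) = 0 := rfl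
  have m1 : mode (1 : Fin (2 * 4)) = 0 := rfl
  have m2 : mode (2 : Fin (2 * 4)) = 1 := rfl
  have m3 : mode (3 : Fin (2 * 4)) = 1 := rfl
  have m4 : mode (4 : Fin (2 * 4)) = 2 := rfl
  have m5 : mode (5 : Fin (2 * 4)) = 2 := rfl
  have m6 : mode (6 : Fin (2 * 4)) = 3 := rfl
  have m7 : mode (7 : Fin (2 * 4)) = 3 := rfl
  simp only [majorana_app, sgn, m0, m1, m2, m3, m4, m5, m6, m7, toggle_vec_zero, toggle_vec_one,
    toggle_vec_two, toggle_vec_three, eta_four]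
  simp
  linear_combination (Ψ ![false, false, false, false] * Ψ ![true, true, true, true]
      - Ψ ![true, true, false, false] * Ψ ![false, false, true, true]
      + Ψ ![true, false, true, false] * Ψ ![false, true, false, true]
      - Ψ ![true, false, false, true] * Ψ ![false, true, true, false]) * Complex.I_mul_I

/-- Gaussian unitaries commuting with the parity operator and with `theta`. -/
structure IsSymmetricGaussian (U : Op 4) : Prop where
  gaussian : IsGaussianUnitary U
  parity : parity 4 * U = U * parity 4
  theta : ∀ Φ, theta (U.app Φ) = U.app (theta Φ)

lemma IsSymmetricGaussian.mul {U V : Op 4} (hU : IsSymmetricGaussian U)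
    (hV : IsSymmetricGaussian V) : IsSymmetricGaussian (U * V) where
  gaussian := hU.gaussian.mul hV.gaussian
  parity := by rw [← mul_assoc, hU.parity, mul_assoc, hV.parity, mul_assoc]
  theta Φ := by rw [app_mul, hU.theta, hV.theta, app_mul]

lemma isSymmetricGaussian_cliff_mul_cliff {w w' : Fin (2 * 4) → ℝ} (hw : ∑ k, w k ^ 2 = 1)
    (hw' : ∑ k, w' k ^ 2 = 1) : IsSymmetricGaussian (cliff w * cliff w') where
  gaussian := (isGaussianUnitary_cliff hw).mul (isGaussianUnitary_cliff hw')
  parity := by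
    rw [← mul_assoc, parity_mul_cliff, neg_mul, mul_assoc, parity_mul_cliff, mul_neg, neg_neg,
      mul_assoc]
  theta Φ := by
    have hn : ∀ (A : Op 4) (Ψ : H 4), A.app (-Ψ) = -A.app Ψ := fun A Ψ => by simp [Op.app]
    rw [app_mul, theta_cliff, theta_cliff, hn, neg_neg, app_mul]

lemma isGaussianUnitary_one {n : ℕ} : IsGaussianUnitary (1 : Op n) :=
  ⟨one_mem _, 1, one_mem _, fun j => by simp [Matrix.one_apply]⟩

lemma isSymmetricGaussian_one : IsSymmetricGaussian 1 where
  gaussian := isGaussianUnitary_one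
  parity := by simp
  theta Φ := by simp only [app_one]

/-! ### Compactness of the symmetric Gaussian unitaries. -/

lemma continuous_app (Φ : H 4) : Continuous fun A : Op 4 => A.app Φ := by
  have : (fun A : Op 4 => A.app Φ) = fun A : Op 4 => WithLp.toLp 2 (A *ᵥ Φ.ofLp) := by
    funext A
    simp [Op.app, Matrix.toLpLin_apply]
  rw [this]
  fun_prop

/-- Symmetric Gaussian unitaries together with their orthogonal matrices. -/
def symmetricGaussianPairs : Set (Op 4 × Matrix (Fin (2 * 4)) (Fin (2 * 4)) ℝ) :=
  {p | (p.1 * star p.1 = 1 ∧ p.2 * p.2ᵀ = 1 ∧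
    ∀ j, p.1 * majorana j * p.1ᴴ = ∑ k, (p.2 j k : ℂ) • majorana k) ∧
    parity 4 * p.1 = p.1 * parity 4 ∧ ∀ Φ, theta (p.1.app Φ) = p.1.app (theta Φ)}

/-- Keeping R as a coordinate turns the Gaussian condition into closed equations on a bounded set; U
is recovered by projection. -/
lemma isSymmetricGaussian_iff {U : Op 4} :
    IsSymmetricGaussian U ↔ ∃ R, (U, R) ∈ symmetricGaussianPairs := by
  constructor
  · rintro ⟨⟨hU, R, hR, h⟩, hp, ht⟩
    exact ⟨R, ⟨Matrix.mem_unitaryGroup_iff.mp hU, (Matrix.mem_orthogonalGroup_iff _ _).mp hR, h⟩,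
      hp, ht⟩
  · rintro ⟨R, ⟨hU, hR, h⟩, hp, ht⟩
    exact ⟨⟨Matrix.mem_unitaryGroup_iff.mpr hU, R, (Matrix.mem_orthogonalGroup_iff _ _).mpr hR, h⟩,
      hp, ht⟩

lemma isClosed_symmetricGaussianPairs : IsClosed symmetricGaussianPairs := by
  have ca : ∀ Φ, Continuous fun p : Op 4 × Matrix (Fin (2 * 4)) (Fin (2 * 4)) ℝ => p.1.app Φ :=
    fun Φ => (continuous_app Φ).comp continuous_fst
  refine (IsClosed.and (isClosed_eq ?_ ?_) (IsClosed.and (isClosed_eq ?_ ?_) ?_)).and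
    (IsClosed.and (isClosed_eq ?_ ?_) ?_)
  · fun_prop
  · fun_prop
  · fun_prop
  · fun_prop
  · simp only [Set.ofPred_forall]
    refine isClosed_iInter fun j => isClosed_eq (by fun_prop) ?_
    refine continuous_finsetSum _ fun k _ => ?_
    have : Continuous fun p : Op 4 × Matrix (Fin (2 * 4)) (Fin (2 * 4)) ℝ => (p.2 j k : ℂ) :=
      Complex.continuous_ofReal.comp (continuous_snd.matrix_elem j k)
    exact this.smul continuous_const
  · fun_prop
  · fun_prop
  · simp only [Set.ofPred_forall]
    exact isClosed_iInter fun Φ => isClosed_eq (continuous_theta.comp (ca Φ)) (ca _)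

lemma isCompact_entries_closedBall (𝕜 m : Type*) [RCLike 𝕜] :
    IsCompact {A : Matrix m m 𝕜 | ∀ i j, A i j ∈ Metric.closedBall (0 : 𝕜) 1} := by
  have h : IsCompact (Set.pi Set.univ fun _ : m => Set.pi Set.univ fun _ : m =>
      Metric.closedBall (0 : 𝕜) 1) :=
    isCompact_univ_pi fun _ => isCompact_univ_pi fun _ => isCompact_closedBall _ _
  have e : {A : Matrix m m 𝕜 | ∀ i j, A i j ∈ Metric.closedBall (0 : 𝕜) 1} =
      (Set.pi Set.univ fun _ : m => Set.pi Set.univ fun _ : m => Metric.closedBall (0 : 𝕜) 1) :=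
    Set.ext fun A => ⟨fun hA i _ j _ => hA i j, fun hA i j => hA i trivial j trivial⟩
  rw [e]
  exact h

lemma isCompact_symmetricGaussianPairs : IsCompact symmetricGaussianPairs := by
  refine ((isCompact_entries_closedBall ℂ _).prod
    (isCompact_entries_closedBall ℝ _)).of_isClosed_subset isClosed_symmetricGaussianPairs ?_
  rintro ⟨U, R⟩ ⟨⟨hU, hR, -⟩, -⟩
  refine ⟨fun i j => ?_, fun i j => ?_⟩
  · rw [mem_closedBall_zero_iff]
    exact entry_norm_bound_of_unitary (Matrix.mem_unitaryGroup_iff.mpr hU) i j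
  · rw [mem_closedBall_zero_iff]
    refine entry_norm_bound_of_unitary (𝕜 := ℝ) (Matrix.mem_unitaryGroup_iff.mpr ?_) i j
    rw [Matrix.star_eq_conjTranspose, Matrix.conjTranspose_eq_transpose_of_trivial]
    exact hR

/-- An orbit of the symmetric Gaussian unitaries has a vector of largest amplitude at `x`. -/
lemma exists_max_amplitude (Ψ : H 4) (x : Fin 4 → Bool) :
    ∃ V, IsSymmetricGaussian V ∧ ∀ U, IsSymmetricGaussian U → ‖U.app Ψ x‖ ≤ ‖V.app Ψ x‖ := by
  obtain ⟨R₁, hR₁⟩ := isSymmetricGaussian_iff.mp isSymmetricGaussian_one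
  set g : Op 4 × Matrix (Fin (2 * 4)) (Fin (2 * 4)) ℝ → ℝ := fun p => ‖p.1.app Ψ x‖ with hg
  have hcont : Continuous g := by
    have h1 : Continuous fun p : Op 4 × Matrix (Fin (2 * 4)) (Fin (2 * 4)) ℝ => p.1.app Ψ :=
      (continuous_app Ψ).comp continuous_fst
    exact ((PiLp.continuous_apply 2 _ x).comp h1).norm
  obtain ⟨p, hp, hmax⟩ :=
    isCompact_symmetricGaussianPairs.exists_isMaxOn ⟨_, hR₁⟩ hcont.continuousOn
  refine ⟨p.1, isSymmetricGaussian_iff.mpr ⟨p.2, hp⟩, fun U hU => ?_⟩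
  obtain ⟨R', hR'⟩ := isSymmetricGaussian_iff.mp hU
  have h2 : g (U, R') ≤ g p := isMaxOn_iff.mp hmax (U, R') hR'
  simpa only [hg] using h2

/-! ### Variation at a maximal vacuum amplitude. -/

lemma re_conj_mul_eq_zero_of_rotation_le {a z : ℂ}
    (h : ∀ t : ℝ, ‖(Real.cos t : ℂ) * a + (Real.sin t : ℂ) * z‖ ≤ ‖a‖) :
    (conj a * z).re = 0 := by
  have h2 : ∀ t : ℝ, Real.sin t ^ 2 * (‖z‖ ^ 2 - ‖a‖ ^ 2)
      + 2 * Real.cos t * Real.sin t * (conj a * z).re ≤ 0 := by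
    intro t
    have h3 := pow_le_pow_left₀ (norm_nonneg _) (h t) 2
    simp only [← Complex.normSq_eq_norm_sq, Complex.normSq_apply] at h3 ⊢
    simp only [Complex.add_re, Complex.add_im, Complex.mul_re, Complex.mul_im, Complex.ofReal_re,
      Complex.ofReal_im, Complex.conj_re, Complex.conj_im] at h3 ⊢
    have := Real.sin_sq_add_cos_sq t
    nlinarith
  set m := (conj a * z).re
  set K := ‖z‖ ^ 2 - ‖a‖ ^ 2
  -- The real part `m` is the first-order term at t = 0. Testing at tan t = ε, small enough for it
  -- to dominate `K`, gives ε²(K + 2(|K| + 1)) ≤ 0 and so replaces differentiation.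
  set ε := m / (|K| + 1) with hε
  have h3 := h2 (Real.arctan ε)
  rw [Real.cos_arctan, Real.sin_arctan] at h3
  have hpos : 0 < Real.sqrt (1 + ε ^ 2) := Real.sqrt_pos.mpr (by positivity)
  have h4 : ε ^ 2 * K + 2 * ε * m ≤ 0 := by
    have e : (ε / √(1 + ε ^ 2)) ^ 2 * K + 2 * (1 / √(1 + ε ^ 2)) * (ε / √(1 + ε ^ 2)) * m
      = (ε ^ 2 * K + 2 * ε * m) / √(1 + ε ^ 2) ^ 2 := by field_simp
    rw [e] at h3
    by_contra hc
    exact absurd h3 (not_le.mpr (div_pos (not_le.mp hc) (by positivity)))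
  have hK : 0 < |K| + 1 := by positivity
  have hm : m = ε * (|K| + 1) := by rw [hε]; field_simp
  have h5 : ε ^ 2 * (K + 2 * (|K| + 1)) ≤ 0 := by rw [hm] at h4; linarith
  have h6 : 0 < K + 2 * (|K| + 1) := by linarith [neg_abs_le K, abs_nonneg K]
  have h7 : ε = 0 := by
    by_contra hne
    exact absurd h5 (not_le.mpr (by positivity))
  rw [hm, h7, zero_mul]

lemma cliff_single {n : ℕ} (p : Fin (2 * n)) (c : ℝ) :
    cliff (Pi.single p c) = (c : ℂ) • majorana p := by
  rw [cliff, Finset.sum_eq_single p]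
  · simp
  · intro k _ hk; simp [hk]
  · simp

lemma cliff_add {n : ℕ} (v w : Fin (2 * n) → ℝ) : cliff (v + w) = cliff v + cliff w := by
  simp only [cliff, Pi.add_apply, Complex.ofReal_add, add_smul, Finset.sum_add_distrib]

lemma sum_sq_single {m : ℕ} (p : Fin m) : ∑ k, (Pi.single p 1 : Fin m → ℝ) k ^ 2 = 1 := by
  rw [Finset.sum_eq_single p] <;> simp +contextual

lemma sum_sq_rotation {m : ℕ} {p q : Fin m} (hpq : p ≠ q) (t : ℝ) :
    ∑ k, (Pi.single p (Real.cos t) + Pi.single q (Real.sin t) : Fin m → ℝ) k ^ 2 = 1 := by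
  have : ∀ k, (Pi.single p (Real.cos t) + Pi.single q (Real.sin t) : Fin m → ℝ) k ^ 2
      = (if k = p then Real.cos t ^ 2 else 0) + if k = q then Real.sin t ^ 2 else 0 := by
    intro k
    simp only [Pi.add_apply, Pi.single_apply]
    split_ifs with h1 h2 h2
    · exact absurd (h1.symm.trans h2) hpq
    all_goals simp
  simp only [this, Finset.sum_add_distrib]
  simp

/-- The rotation `cos t + sin t • c_p c_q`. -/
lemma isSymmetricGaussian_rotation {p q : Fin (2 * 4)} (hpq : p ≠ q) (t : ℝ) :
    IsSymmetricGaussian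
      ((Real.cos t : ℂ) • (1 : Op 4) + (Real.sin t : ℂ) • (majorana p * majorana q)) := by
  -- The rotation is c_p (cos t c_p + sin t c_q), a product of two unit Majorana vectors.
  have h := isSymmetricGaussian_cliff_mul_cliff (sum_sq_single p) (sum_sq_rotation hpq t)
  rw [cliff_add, cliff_single, cliff_single, cliff_single, mul_add, Complex.ofReal_one, one_smul,
    mul_smul_comm, mul_smul_comm, majorana_mul_self] at h
  exact h

lemma isSymmetricGaussian_majorana_mul {p q : Fin (2 * 4)} (hpq : p ≠ q) :
    IsSymmetricGaussian (majorana p * majorana q) := by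
  simpa using isSymmetricGaussian_rotation hpq (Real.pi / 2)

/-- If no symmetric Gaussian unitary increases the vacuum amplitude, then the vacuum amplitude or
all the two-particle amplitudes vanish. -/
lemma conj_mul_pair_eq_zero {Φ : H 4}
    (hmax : ∀ U, IsSymmetricGaussian U → ‖U.app Φ fun _ => false‖ ≤ ‖Φ fun _ => false‖)
    {j k : Fin 4} (hjk : j < k) :
    conj (Φ fun _ => false) * Φ (toggle k (toggle j fun _ => false)) = 0 := by
  set a := Φ fun _ => false
  set b := Φ (toggle k (toggle j fun _ => false))
  have hrot : ∀ p q : Fin (2 * 4), p ≠ q →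
      (conj a * (Op.app (majorana p * majorana q) Φ fun _ => false)).re = 0 := by
    intro p q hpq
    refine re_conj_mul_eq_zero_of_rotation_le fun t => ?_
    have := hmax _ (isSymmetricGaussian_rotation hpq t)
    simpa [Op.app, -Complex.coe_smul] using this
  have hz : ∀ j : Fin 4, eta j (fun _ => false) = 0 := fun j => by simp [eta]
  have hj := j.isLt
  have hk := k.isLt
  have hjk' : j.val < k.val := hjk
  set p0 : Fin (2 * 4) := ⟨2 * j.val, by omega⟩ with hp0
  set p1 : Fin (2 * 4) := ⟨2 * j.val + 1, by omega⟩ with hp1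
  set q : Fin (2 * 4) := ⟨2 * k.val, by omega⟩ with hq
  have mp0 : mode p0 = j := Fin.ext (by simp only [mode, hp0]; omega)
  have mp1 : mode p1 = j := Fin.ext (by simp only [mode, hp1]; omega)
  have mq : mode q = k := Fin.ext (by simp only [mode, hq]; omega)
  have v0 : p0.val % 2 = 0 := by simp only [hp0]; omega
  have v1 : p1.val % 2 ≠ 0 := by simp only [hp1]; omega
  have vq : q.val % 2 = 0 := by simp only [hq]; omega
  have e0 : (Op.app (majorana p0 * majorana q) Φ fun _ => false) = -b := by
    rw [app_mul, majorana_app, majorana_app, mp0, mq]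
    simp only [sgn, mp0, mq, v0, vq, if_true, neg_one_pow_eta_toggle, hjk, hz]
    simp [b]
  have e1 : (Op.app (majorana p1 * majorana q) Φ fun _ => false) = -(Complex.I * b) := by
    rw [app_mul, majorana_app, majorana_app, mp1, mq]
    simp only [sgn, mp1, mq, if_neg v1, vq, if_true, neg_one_pow_eta_toggle, hjk, hz]
    simp [b]
  -- Switching between the two Majoranas of mode `j` multiplies the transported amplitude by i, so
  -- the two conditions kill the real and the imaginary part.
  have h0 := hrot p0 q (Fin.ne_of_val_ne (by simp only [hp0, hq]; omega))
  have h1 := hrot p1 q (Fin.ne_of_val_ne (by simp only [hp1, hq]; omega))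
  rw [e0] at h0
  rw [e1] at h1
  refine Complex.ext ?_ ?_
  · simp only [Complex.mul_re, Complex.neg_re, Complex.neg_im, Complex.zero_re] at h0 ⊢
    linarith
  · simp only [Complex.mul_re, Complex.mul_im, Complex.neg_re, Complex.neg_im, Complex.I_re,
      Complex.I_im, Complex.zero_im] at h1 ⊢
    linarith

lemma sgn_ne_zero {n : ℕ} (k : Fin (2 * n)) (y : Fin n → Bool) : sgn k y ≠ 0 :=
  left_ne_zero_of_mul_eq_one (sgn_mul_sgn_toggle_self k y)

/-- A vector whose symmetric Gaussian orbit has no larger vacuum amplitude has no two-particle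
amplitudes. -/
lemma pair_eq_zero_of_max {Φ : H 4}
    (hmax : ∀ U, IsSymmetricGaussian U → ‖U.app Φ fun _ => false‖ ≤ ‖Φ fun _ => false‖)
    {j k : Fin 4} (hjk : j < k) : Φ (toggle k (toggle j fun _ => false)) = 0 := by
  -- If the maximum is zero, c_p c_q would carry the pair amplitude to the vacuum, so that amplitude
  -- vanishes too.
  by_cases h0 : Φ (fun _ => false) = 0
  · have hjk' : j.val < k.val := hjk
    have hk := k.isLt
    set p : Fin (2 * 4) := ⟨2 * j.val, by omega⟩ with hp
    set q : Fin (2 * 4) := ⟨2 * k.val, by omega⟩ with hq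
    have mp : mode p = j := Fin.ext (by simp only [mode, hp]; omega)
    have mq : mode q = k := Fin.ext (by simp only [mode, hq]; omega)
    have hpq : p ≠ q := Fin.ne_of_val_ne (by simp only [hp, hq]; omega)
    have h := hmax _ (isSymmetricGaussian_majorana_mul hpq)
    rw [h0, norm_zero, norm_le_zero_iff, app_mul, majorana_app, majorana_app, mp, mq] at h
    simpa [sgn_ne_zero] using h
  · exact (mul_eq_zero.mp (conj_mul_pair_eq_zero hmax hjk)).resolve_left (by simpa using h0)

/-- Without pair amplitudes the quadric reduces to Φ₀₀₀₀ Φ₁₁₁₁ = 0. If Φ₀₀₀₀ itself vanishes, a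
product of four Majoranas carries Φ₁₁₁₁ to the vacuum and maximality kills it. -/
lemma eq_smul_vacuum_of_max {Φ : H 4} (hpar : Φ ∈ posParity 4) (hQ : ⟪theta Φ, Φ⟫_ℂ = 0)
    (hmax : ∀ U, IsSymmetricGaussian U → ‖U.app Φ fun _ => false‖ ≤ ‖Φ fun _ => false‖) :
    Φ = Φ (fun _ => false) • vacuum 4 := by
  have hz : (fun _ : Fin 4 => false) = ![false, false, false, false] := vec_eta _
  have hpair : ∀ j k : Fin 4, j < k → Φ (toggle k (toggle j fun _ => false)) = 0 :=
    fun j k => pair_eq_zero_of_max hmax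
  have h01 := hpair 0 1 (by decide)
  have h02 := hpair 0 2 (by decide)
  have h03 := hpair 0 3 (by decide)
  have h12 := hpair 1 2 (by decide)
  have h13 := hpair 1 3 (by decide)
  have h23 := hpair 2 3 (by decide)
  have hfull : Φ ![true, true, true, true] = 0 := by
    by_cases h0 : Φ (fun _ => false) = 0
    · have h := hmax _ ((isSymmetricGaussian_majorana_mul (p := 0) (q := 2) (by decide)).mul
        (isSymmetricGaussian_majorana_mul (p := 4) (q := 6) (by decide)))
      have m0 : mode (0 : Fin (2 * 4)) = 0 := rfl
      have m2 : mode (2 : Fin (2 * 4)) = 1 := rfl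
      have m4 : mode (4 : Fin (2 * 4)) = 2 := rfl
      have m6 : mode (6 : Fin (2 * 4)) = 3 := rfl
      rw [h0, norm_zero, norm_le_zero_iff, app_mul, app_mul, app_mul, majorana_app, majorana_app,
        majorana_app, majorana_app, m0, m2, m4, m6, hz, toggle_vec_zero, toggle_vec_one,
        toggle_vec_two, toggle_vec_three] at h
      simpa [sgn_ne_zero] using h
    · rw [inner_theta_self hpar] at hQ
      rw [hz] at h01 h02 h03 h0
      simp only [toggle_vec_zero, toggle_vec_one, toggle_vec_two, toggle_vec_three,
        Bool.not_false] at h01 h02 h03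
      simpa [h01, h02, h03, h0] using hQ
  rw [hz] at h01 h02 h03 h12 h13 h23
  simp only [toggle_vec_zero, toggle_vec_one, toggle_vec_two, toggle_vec_three,
    Bool.not_false] at h01 h02 h03 h12 h13 h23
  rw [mem_posParity_iff] at hpar
  ext y
  rw [PiLp.smul_apply, hz, vec_eta y]
  have hv : ∀ a b c d : Bool, vacuum 4 ![a, b, c, d] =
      if a = false ∧ b = false ∧ c = false ∧ d = false then 1 else 0 := by
    intro a b c d
    simp only [vacuum, ket, hz, PiLp.single_apply]
    congr 1
    simp
  rw [hv]
  have hodd : ∀ a b c d : Bool, wt ![a, b, c, d] = -1 → Φ ![a, b, c, d] = 0 :=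
    fun a b c d => hpar _
  simp only [wt_vec] at hodd
  have o1 := hodd true false false false (by norm_num)
  have o2 := hodd false true false false (by norm_num)
  have o3 := hodd false false true false (by norm_num)
  have o4 := hodd false false false true (by norm_num)
  have o5 := hodd false true true true (by norm_num)
  have o6 := hodd true false true true (by norm_num)
  have o7 := hodd true true false true (by norm_num)
  have o8 := hodd true true true false (by norm_num)
  cases y 0 <;> cases y 1 <;> cases y 2 <;> cases y 3 <;>
    simp [h01, h02, h03, h12, h13, h23, hfull, o1, o2, o3, o4, o5, o6, o7, o8]

/-- An even unit vector is Gaussian if it is orthogonal to its `theta`-image. -/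
lemma mem_posGaussianStates_of_inner_theta {Ψ : H 4} (hpar : Ψ ∈ posParity 4) (hnorm : ‖Ψ‖ = 1)
    (hQ : ⟪theta Ψ, Ψ⟫_ℂ = 0) : Ψ ∈ posGaussianStates 4 := by
  refine ⟨?_, hpar⟩
  obtain ⟨V, hV, hmax⟩ := exists_max_amplitude Ψ fun _ => false
  have hU := hV.gaussian.1
  have h1 : V.app Ψ = V.app Ψ (fun _ => false) • vacuum 4 := by
    refine eq_smul_vacuum_of_max ?_ ?_ fun U hU' => ?_
    · change (parity 4).app (V.app Ψ) = V.app Ψ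
      rw [← app_mul, hV.parity, app_mul, (hpar : (parity 4).app Ψ = Ψ)]
    · rw [hV.theta, inner_app_app hU, hQ]
    · rw [← app_mul]
      exact hmax _ (hU'.mul hV)
  set c := V.app Ψ fun _ => false
  have hc : ‖c‖ = 1 := by
    have h2 := norm_app hU Ψ
    rw [h1, norm_smul, hnorm] at h2
    simpa [vacuum, ket] using h2
  refine ⟨Complex.arg c, Vᴴ, hV.gaussian.conjTranspose, ?_⟩
  have hexp : Complex.exp (Complex.I * Complex.arg c) = c := by
    have h3 := Complex.norm_mul_exp_arg_mul_I c
    rwa [hc, Complex.ofReal_one, one_mul, mul_comm] at h3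
  rw [hexp, ← app_conjTranspose_app hU Ψ, h1]
  simp [Op.app]

lemma theta_mem_posGaussianStates {Ψ : H 4} (h : Ψ ∈ posGaussianStates 4) :
    theta Ψ ∈ posGaussianStates 4 := by
  refine mem_posGaussianStates_of_inner_theta (theta_mem_posParity h.2) ?_ ?_
  · rw [norm_theta, norm_of_mem_gaussianStates h.1]
  · rw [inner_theta_theta, ← inner_conj_symm, inner_theta_of_mem_posGaussianStates h, map_zero]

/-! ### The decomposition along a Gaussian state and its `theta`-image -/

lemma inner_theta_comm (Ψ Φ : H 4) : ⟪theta Ψ, Φ⟫_ℂ = ⟪theta Φ, Ψ⟫_ℂ := by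
  conv_lhs => rw [← theta_theta Φ]
  rw [inner_theta_theta]

lemma inner_self_of_norm_eq_one {Ψ : H 4} (h : ‖Ψ‖ = 1) : ⟪Ψ, Ψ⟫_ℂ = 1 := by
  rw [inner_self_eq_norm_sq_to_K, h]; simp

lemma smul_mem_posParity {Ψ : H 4} (h : Ψ ∈ posParity 4) (c : ℂ) : c • Ψ ∈ posParity 4 := by
  rw [mem_posParity_iff] at h ⊢
  intro y hy
  simp [h y hy]

lemma add_mem_posParity {Ψ Φ : H 4} (h : Ψ ∈ posParity 4) (h' : Φ ∈ posParity 4) :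
    Ψ + Φ ∈ posParity 4 := by
  rw [mem_posParity_iff] at h h' ⊢
  intro y hy
  simp [h y hy, h' y hy]

lemma vacuum_mem_posParity : vacuum 4 ∈ posParity 4 := by
  rw [mem_posParity_iff]
  intro y hy
  have hne : y ≠ fun _ => false := by
    rintro rfl
    norm_num [wt] at hy
  simp [vacuum, ket, hne]

/-- The phase is a square root because ⟪θΨ, Ψ⟫ scales quadratically in Ψ. Half a negative argument
is shifted by π, which changes only the sign of the root. -/
lemma exists_phase (z : ℂ) :
    ∃ φ ∈ Set.Ico 0 (2 * Real.pi), z = ‖z‖ * Complex.exp (Complex.I * (φ : ℝ)) ^ 2 := by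
  have hz := Complex.norm_mul_exp_arg_mul_I z
  have h1 := Complex.neg_pi_lt_arg z
  have h2 := Complex.arg_le_pi z
  have hpi := Real.pi_pos
  rcases le_or_gt 0 (Complex.arg z) with h | h
  · refine ⟨Complex.arg z / 2, ⟨by linarith, by linarith⟩, ?_⟩
    rw [← Complex.exp_nat_mul]
    conv_lhs => rw [← hz]
    congr 2
    push_cast
    ring
  · refine ⟨Complex.arg z / 2 + Real.pi, ⟨by linarith, by linarith⟩, ?_⟩
    rw [← Complex.exp_nat_mul]
    conv_lhs => rw [← hz, ← Complex.exp_periodic]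
    congr 2
    push_cast
    ring

/-- A `theta`-real even unit vector is the balanced superposition of a Gaussian state and its
`theta`-image. -/
lemma exists_gaussian_of_theta_eq {Φ : H 4} (hpar : Φ ∈ posParity 4) (hnorm : ‖Φ‖ = 1)
    (hΦ : theta Φ = Φ) :
    ∃ g ∈ posGaussianStates 4, Φ = ((√(1 / 2) : ℝ) : ℂ) • g + ((√(1 / 2) : ℝ) : ℂ) • theta g := by
  set z := ⟪Φ, vacuum 4⟫_ℂ
  -- The phase `l` makes ⟪Φ, l • vacuum⟫ purely imaginary, so that the `theta`-real part of l •
  -- vacuum is orthogonal to `Φ`.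
  obtain ⟨l, hl, hlz⟩ : ∃ l : ℂ, l * conj l = 1 ∧ l * z + conj (l * z) = 0 := by
    by_cases hz : z = 0
    · exact ⟨1, by simp, by simp [hz]⟩
    · have hz' : (‖z‖ : ℂ) ≠ 0 := by simpa using hz
      have hzz : z * conj z = (‖z‖ : ℂ) ^ 2 := Complex.mul_conj' z
      refine ⟨Complex.I * conj z / ‖z‖, ?_, ?_⟩
      · simp only [map_div₀, map_mul, Complex.conj_I, Complex.conj_conj, Complex.conj_ofReal]
        field_simp
        linear_combination hzz - (z * conj z) * Complex.I_sq
      · simp only [map_div₀, map_mul, Complex.conj_I, Complex.conj_conj, Complex.conj_ofReal]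
        ring
  set u := l • vacuum 4
  have hvac : ‖vacuum 4‖ = 1 := by simp [vacuum, ket]
  have huu : ⟪u, u⟫_ℂ = 1 := by
    rw [inner_smul_left, inner_smul_right, inner_self_of_norm_eq_one hvac]
    linear_combination hl
  have hQv : ⟪theta (vacuum 4), vacuum 4⟫_ℂ = 0 := by
    rw [inner_theta_self vacuum_mem_posParity]
    have e : ∀ a b c d : Bool, (a || b || c || d) = true → vacuum 4 ![a, b, c, d] = 0 := by
      intro a b c d h
      have : ![a, b, c, d] ≠ fun _ => false := by
        intro hf
        have h0 := congrFun hf 0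
        have h1 := congrFun hf 1
        have h2 := congrFun hf 2
        have h3 := congrFun hf 3
        simp at h0 h1 h2 h3
        simp [h0, h1, h2, h3] at h
      simp [vacuum, ket, this]
    rw [e true true true true rfl, e true true false false rfl, e true false true false rfl,
      e true false false true rfl]
    simp
  have hQu : ⟪theta u, u⟫_ℂ = 0 := by
    rw [theta_smul, inner_smul_left, inner_smul_right, hQv]; simp
  have hQu' : ⟪u, theta u⟫_ℂ = 0 := by rw [← inner_conj_symm, hQu, map_zero]
  have hΦu : ⟪Φ, u⟫_ℂ = l * z := by rw [inner_smul_right]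
  have hΦtu : ⟪Φ, theta u⟫_ℂ = conj (l * z) := by
    rw [← hΦu, inner_conj_symm, ← inner_theta_theta, theta_theta, hΦ]
  have hΦΦ := inner_self_of_norm_eq_one hnorm
  set r : ℂ := ((√(1 / 2) : ℝ) : ℂ)
  have hr : r * r = 1 / 2 := by
    have : √(1 / 2) * √(1 / 2) = (1 / 2 : ℝ) := Real.mul_self_sqrt (by norm_num)
    simp only [r]
    rw [← Complex.ofReal_mul, this]
    norm_num
  have hrc : conj r = r := Complex.conj_ofReal _
  set v := r • (u + theta u)
  have hv : theta v = v := by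
    simp only [v, theta_smul, theta_add, theta_theta, hrc, add_comm]
  have hΦv : ⟪Φ, v⟫_ℂ = 0 := by
    rw [inner_smul_right, inner_add_right, hΦu, hΦtu, hlz, mul_zero]
  have hvΦ : ⟪v, Φ⟫_ℂ = 0 := by rw [← inner_conj_symm, hΦv, map_zero]
  have hvv : ⟪v, v⟫_ℂ = 1 := by
    rw [inner_smul_right, inner_smul_left, inner_add_right, inner_add_left, inner_add_left,
      inner_theta_theta, huu, hQu, hQu', hrc]
    linear_combination 2 * hr
  have hupar : u ∈ posParity 4 := smul_mem_posParity vacuum_mem_posParity _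
  have hvpar : v ∈ posParity 4 := smul_mem_posParity
    (add_mem_posParity hupar (theta_mem_posParity hupar)) _
  have htg : theta (r • (Φ + Complex.I • v)) = r • (Φ - Complex.I • v) := by
    rw [theta_smul, theta_add, theta_smul, hv, hΦ, hrc, Complex.conj_I, neg_smul, sub_eq_add_neg]
  refine ⟨r • (Φ + Complex.I • v), ?_, ?_⟩
  · refine mem_posGaussianStates_of_inner_theta
      (smul_mem_posParity (add_mem_posParity hpar (smul_mem_posParity hvpar _)) _) ?_ ?_
    · have h1 : ⟪r • (Φ + Complex.I • v), r • (Φ + Complex.I • v)⟫_ℂ = 1 := by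
        simp only [inner_smul_left, inner_smul_right, inner_add_left, inner_add_right, hΦΦ, hΦv,
          hvΦ, hvv, hrc, Complex.conj_I]
        linear_combination 2 * hr - (r * r) * Complex.I_mul_I
      rw [@norm_eq_sqrt_re_inner ℂ, h1]; simp
    · rw [htg]
      simp only [inner_smul_left, inner_smul_right, inner_sub_left, inner_add_right, hΦΦ, hΦv,
        hvΦ, hvv, hrc, Complex.conj_I]
      linear_combination (r * r) * Complex.I_mul_I
  · rw [htg, ← smul_add, ← smul_add, smul_smul, hr]
    module

/-- The decomposition of an even unit vector `Φ` for which `⟪θ Φ, Φ⟫` is real and nonnegative. -/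
lemma exists_gaussian_decomposition {Φ : H 4} (hpar : Φ ∈ posParity 4) (hnorm : ‖Φ‖ = 1)
    {C : ℝ} (hC : 0 ≤ C) (hQ : ⟪theta Φ, Φ⟫_ℂ = C) :
    ∃ f ∈ Set.Icc (1 / 2 : ℝ) 1, ∃ g ∈ posGaussianStates 4,
      Φ = (√f : ℂ) • g + (√(1 - f) : ℂ) • theta g := by
  have hΦΦ := inner_self_of_norm_eq_one hnorm
  have hQ' : ⟪Φ, theta Φ⟫_ℂ = C := by rw [← inner_conj_symm, hQ, Complex.conj_ofReal]
  have hC1 : C ≤ 1 := by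
    have h := norm_inner_le_norm (𝕜 := ℂ) (theta Φ) Φ
    rwa [hQ, norm_theta, hnorm, mul_one, Complex.norm_real, Real.norm_of_nonneg hC] at h
  rcases hC1.eq_or_lt with rfl | hlt
  -- Equality in Cauchy–Schwarz: here ‖θΦ - Φ‖² = 2 - 2C = 0.
  · have hΦ : theta Φ = Φ := by
      rw [← sub_eq_zero, ← inner_self_eq_zero (𝕜 := ℂ)]
      simp only [inner_sub_left, inner_sub_right, inner_theta_theta, hQ, hQ', hΦΦ]
      simp
    obtain ⟨g, hg, h⟩ := exists_gaussian_of_theta_eq hpar hnorm hΦ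
    refine ⟨1 / 2, by norm_num, g, hg, ?_⟩
    rw [show (1 - 1 / 2 : ℝ) = 1 / 2 by norm_num]
    exact h
  -- With f = (1 + w)/2, w is √f² - √(1-f)², the determinant of the linear system for g and θg; it
  -- is nonzero because C < 1.
  · set w := √(1 - C ^ 2)
    have hpos : 0 < 1 - C ^ 2 := by nlinarith
    have hw2 : w ^ 2 = 1 - C ^ 2 := Real.sq_sqrt hpos.le
    have hw0 : 0 < w := Real.sqrt_pos.mpr hpos
    have hw1 : w ≤ 1 := by nlinarith
    set f := (1 + w) / 2 with hf
    set s := √f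
    set t := √(1 - f)
    have hs : s ^ 2 = f := Real.sq_sqrt (by linarith)
    have ht : t ^ 2 = 1 - f := Real.sq_sqrt (by linarith)
    have hst : 2 * (s * t) = C := by
      have h2 : (2 * (s * t)) ^ 2 = C ^ 2 := by
        rw [mul_pow, mul_pow, hs, ht, hf]; linarith
      exact (pow_left_inj₀ (by positivity) hC two_ne_zero).mp h2
    have cs : (s : ℂ) ^ 2 + (t : ℂ) ^ 2 = 1 := by
      have : s ^ 2 + t ^ 2 = 1 := by rw [hs, ht]; ring
      exact_mod_cast this
    have cw : (s : ℂ) ^ 2 - (t : ℂ) ^ 2 = w := by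
      have : s ^ 2 - t ^ 2 = w := by rw [hs, ht, hf]; ring
      exact_mod_cast this
    have cst : 2 * ((s : ℂ) * t) = C := by exact_mod_cast hst
    have cw2 : (w : ℂ) ^ 2 = 1 - (C : ℂ) ^ 2 := by exact_mod_cast hw2
    have cw0 : (w : ℂ) ≠ 0 := by exact_mod_cast hw0.ne'
    have htg : theta ((w : ℂ)⁻¹ • ((s : ℂ) • Φ - (t : ℂ) • theta Φ))
        = (w : ℂ)⁻¹ • ((s : ℂ) • theta Φ - (t : ℂ) • Φ) := by
      simp only [theta_smul, theta_sub, theta_theta, map_inv₀, Complex.conj_ofReal]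
    refine ⟨f, ⟨by linarith, by linarith⟩, (w : ℂ)⁻¹ • ((s : ℂ) • Φ - (t : ℂ) • theta Φ), ?_, ?_⟩
    · refine mem_posGaussianStates_of_inner_theta (smul_mem_posParity ?_ _) ?_ ?_
      · rw [sub_eq_add_neg, ← neg_smul]
        exact add_mem_posParity (smul_mem_posParity hpar _)
          (smul_mem_posParity (theta_mem_posParity hpar) _)
      · have h1 : ⟪(w : ℂ)⁻¹ • ((s : ℂ) • Φ - (t : ℂ) • theta Φ),
            (w : ℂ)⁻¹ • ((s : ℂ) • Φ - (t : ℂ) • theta Φ)⟫_ℂ = 1 := by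
          simp only [inner_smul_left, inner_smul_right, inner_sub_left, inner_sub_right,
            inner_theta_theta, hΦΦ, hQ, hQ', map_inv₀, Complex.conj_ofReal]
          field_simp
          rw [cw2]
          linear_combination cs - C * cst
        rw [@norm_eq_sqrt_re_inner ℂ, h1]; simp
      · rw [htg]
        simp only [inner_smul_left, inner_smul_right, inner_sub_left, inner_sub_right,
          inner_theta_theta, hΦΦ, hQ, hQ', map_inv₀, Complex.conj_ofReal]
        linear_combination ((w : ℂ)⁻¹ * (w : ℂ)⁻¹) * (C * cs - cst)
    · rw [htg]
      have e : Φ = ((w : ℂ)⁻¹ * ((s : ℂ) ^ 2 - (t : ℂ) ^ 2)) • Φ := by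
        rw [cw, inv_mul_cancel₀ cw0, one_smul]
      conv_lhs => rw [e]
      module

/-! ### Uniqueness of the decomposition and the fidelity. -/

namespace IsGaussianDecomposition

variable {Ψ g : H 4} {f φ : ℝ}

lemma norm_eq_one (h : IsGaussianDecomposition Ψ f φ g) : ‖g‖ = 1 :=
  norm_of_mem_gaussianStates h.gaussian.1

lemma inner_theta (h : IsGaussianDecomposition Ψ f φ g) :
    ⟪theta Ψ, Ψ⟫_ℂ = Complex.exp (Complex.I * φ) ^ 2 * (2 * ((√f : ℂ) * (√(1 - f) : ℂ))) := by
  have h1 := inner_theta_of_mem_posGaussianStates h.gaussian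
  have h2 : ⟪g, theta g⟫_ℂ = 0 := by rw [← inner_conj_symm, h1, map_zero]
  have h3 := inner_self_of_norm_eq_one h.norm_eq_one
  rw [h.eq]
  simp only [theta_smul, theta_add, theta_theta, inner_smul_left, inner_smul_right,
    inner_add_left, inner_add_right, inner_theta_theta, h1, h2, h3, Complex.conj_ofReal,
    Complex.conj_conj]
  ring

lemma norm_inner_theta (h : IsGaussianDecomposition Ψ f φ g) :
    ‖⟪theta Ψ, Ψ⟫_ℂ‖ = 2 * (√f * √(1 - f)) := by
  rw [h.inner_theta, norm_mul, norm_pow, mul_comm Complex.I, Complex.norm_exp_ofReal_mul_I,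
    one_pow, one_mul]
  have : (2 * ((√f : ℂ) * (√(1 - f) : ℂ))) = ((2 * (√f * √(1 - f)) : ℝ) : ℂ) := by push_cast; rfl
  rw [this, Complex.norm_real, Real.norm_of_nonneg (by positivity)]

lemma weight_unique {f' φ' : ℝ} {g' : H 4} (h : IsGaussianDecomposition Ψ f φ g)
    (h' : IsGaussianDecomposition Ψ f' φ' g') : f' = f := by
  have e := h.norm_inner_theta.symm.trans h'.norm_inner_theta
  have hf := h.weight
  have hf' := h'.weight
  have e2 : 4 * (f * (1 - f)) = 4 * (f' * (1 - f')) := by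
    have := congrArg (· ^ 2) e
    simp only [mul_pow] at this
    rw [Real.sq_sqrt (by linarith [hf.1]), Real.sq_sqrt (by linarith [hf.2]),
      Real.sq_sqrt (by linarith [hf'.1]), Real.sq_sqrt (by linarith [hf'.2])] at this
    linarith
  -- On [1/2, 1] the quantity 2f - 1 is nonnegative, so its square determines f.
  have e3 : (2 * f' - 1) ^ 2 = (2 * f - 1) ^ 2 := by linarith
  have := (pow_left_inj₀ (by linarith [hf'.1]) (by linarith [hf.1]) two_ne_zero).mp e3
  linarith

/-- Eliminates θg between Ψ and e^{2iφ} θΨ. The right side involves φ only through √(1-f) e^{2iφ},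
which Ψ and f determine. -/
lemma smul_smul_eq (h : IsGaussianDecomposition Ψ f φ g) :
    ((2 * f - 1 : ℝ) : ℂ) • Complex.exp (Complex.I * φ) • g =
      (√f : ℂ) • Ψ - ((√(1 - f) : ℂ) * Complex.exp (Complex.I * φ) ^ 2) • theta Ψ := by
  have hs : (√f : ℂ) ^ 2 = f := by exact_mod_cast Real.sq_sqrt (by linarith [h.weight.1])
  have ht : (√(1 - f) : ℂ) ^ 2 = 1 - f := by
    exact_mod_cast Real.sq_sqrt (sub_nonneg.mpr h.weight.2)
  have he : Complex.exp (Complex.I * φ) * conj (Complex.exp (Complex.I * φ)) = 1 := by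
    rw [Complex.mul_conj', mul_comm Complex.I, Complex.norm_exp_ofReal_mul_I]; simp
  set e := Complex.exp (Complex.I * φ)
  have hθ : e ^ 2 • theta Ψ = e • ((√f : ℂ) • theta g + (√(1 - f) : ℂ) • g) := by
    rw [h.eq, theta_smul, theta_add, theta_smul, theta_smul, theta_theta, smul_smul,
      Complex.conj_ofReal, Complex.conj_ofReal, pow_two, mul_assoc, he, mul_one]
  rw [mul_smul, hθ]
  nth_rewrite 1 [h.eq]
  have : ((2 * f - 1 : ℝ) : ℂ) = (√f : ℂ) ^ 2 - (√(1 - f) : ℂ) ^ 2 := by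
    rw [hs, ht]; push_cast; ring
  rw [this]
  module

/-- The factor √(1-f) is kept so that f = 1, where the phase is arbitrary, is covered. -/
lemma exp_sq_mul_eq {φ' : ℝ} {g' : H 4} (h : IsGaussianDecomposition Ψ f φ g)
    (h' : IsGaussianDecomposition Ψ f φ' g') :
    (√(1 - f) : ℂ) * Complex.exp (Complex.I * φ) ^ 2 =
      (√(1 - f) : ℂ) * Complex.exp (Complex.I * φ') ^ 2 := by
  have hs : (√f : ℂ) ≠ 0 := by
    exact_mod_cast (Real.sqrt_pos.mpr (by linarith [h.weight.1])).ne'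
  have e := h.inner_theta.symm.trans h'.inner_theta
  refine mul_left_cancel₀ (mul_ne_zero two_ne_zero hs) ?_
  linear_combination e

lemma component_unique (hf : 1 / 2 < f) {φ' : ℝ} {g' : H 4}
    (h : IsGaussianDecomposition Ψ f φ g) (h' : IsGaussianDecomposition Ψ f φ' g') :
    Complex.exp (Complex.I * φ) • g = Complex.exp (Complex.I * φ') • g' := by
  have e := h.smul_smul_eq
  rw [exp_sq_mul_eq h h', ← h'.smul_smul_eq] at e
  have hne : ((2 * f - 1 : ℝ) : ℂ) ≠ 0 := by
    have : (2 * f - 1 : ℝ) ≠ 0 := by linarith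
    exact_mod_cast this
  exact smul_right_injective _ hne e

lemma pair_unique (hf : 1 / 2 < f) (hf1 : f < 1) {φ' : ℝ} {g' : H 4}
    (h : IsGaussianDecomposition Ψ f φ g) (h' : IsGaussianDecomposition Ψ f φ' g') :
    (φ' = φ ∧ g' = g) ∨
      (Complex.exp (Complex.I * φ') = -Complex.exp (Complex.I * φ) ∧ g' = -g) := by
  have ht : (√(1 - f) : ℂ) ≠ 0 := by
    exact_mod_cast (Real.sqrt_pos.mpr (by linarith)).ne'
  have hsq := mul_left_cancel₀ ht (exp_sq_mul_eq h h')
  have hg := component_unique hf h h'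
  have he := Complex.exp_ne_zero (Complex.I * φ)
  rcases sq_eq_sq_iff_eq_or_eq_neg.mp hsq.symm with e | e
  · left
    rw [e] at hg
    refine ⟨?_, (smul_right_injective _ he hg).symm⟩
    obtain ⟨m, hm⟩ := Complex.exp_eq_exp_iff_exists_int.mp e
    have hm' : φ' = φ + m * (2 * Real.pi) := by
      have := congrArg Complex.im hm
      simpa using this
    have h1 := h.phase
    have h2 := h'.phase
    have hpi := Real.two_pi_pos
    have hm0 : m = 0 := by
      have a1 : (m : ℝ) < 1 := by
        by_contra hc
        nlinarith [h1.1, h2.2]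
      have a2 : (-1 : ℝ) < m := by
        by_contra hc
        nlinarith [h1.2, h2.1]
      have b1 : m < 1 := by exact_mod_cast a1
      have b2 : -1 < m := by exact_mod_cast a2
      omega
    rw [hm', hm0]; simp
  · right
    refine ⟨e, ?_⟩
    rw [e, neg_smul, ← smul_neg] at hg
    rw [smul_right_injective _ he hg, neg_neg]

/-- The modulus of the overlap with a Gaussian state is at most the square root of the weight. -/
lemma norm_inner_sq_le (h : IsGaussianDecomposition Ψ f φ g) {χ : H 4}
    (hχ : χ ∈ posGaussianStates 4) : ‖⟪χ, Ψ⟫_ℂ‖ ^ 2 ≤ f := by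
  have h1 := inner_theta_of_mem_posGaussianStates h.gaussian
  have h2 : ⟪g, theta g⟫_ℂ = 0 := by rw [← inner_conj_symm, h1, map_zero]
  have h3 := inner_self_of_norm_eq_one h.norm_eq_one
  have hχ1 := inner_self_of_norm_eq_one (norm_of_mem_gaussianStates hχ.1)
  have hχ0 := inner_theta_of_mem_posGaussianStates hχ
  set a := ⟪g, χ⟫_ℂ with ha
  set b := ⟪theta g, χ⟫_ℂ with hb
  have hca : ⟪χ, g⟫_ℂ = conj a := by rw [ha, inner_conj_symm]
  have hcb : ⟪χ, theta g⟫_ℂ = conj b := by rw [hb, inner_conj_symm]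
  have hb' : ⟪theta χ, g⟫_ℂ = b := inner_theta_comm _ _
  set r := χ - a • g - b • theta g with hr
  have hQ : ⟪theta r, r⟫_ℂ = -(2 * (a * b)) := by
    simp only [hr, theta_sub, theta_smul, theta_theta, inner_sub_left, inner_sub_right,
      inner_smul_left, inner_smul_right, inner_theta_theta, Complex.conj_conj, hχ0, h1, h2, h3,
      hb', ← ha, ← hb]
    ring
  have hN : ⟪r, r⟫_ℂ = 1 - a * conj a - b * conj b := by
    simp only [hr, inner_sub_left, inner_sub_right, inner_smul_left, inner_smul_right,
      inner_theta_theta, hχ1, h1, h2, h3, hca, hcb, ← ha, ← hb]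
    ring
  have hN' : ‖r‖ ^ 2 = 1 - ‖a‖ ^ 2 - ‖b‖ ^ 2 := by
    rw [inner_self_eq_norm_sq_to_K, Complex.mul_conj', Complex.mul_conj'] at hN
    have hN2 : ((‖r‖ : ℂ)) ^ 2 = 1 - (‖a‖ : ℂ) ^ 2 - (‖b‖ : ℂ) ^ 2 := hN
    exact_mod_cast hN2
  -- Isotropy of χ leaves ⟪θr, r⟫ = -2ab, so Cauchy–Schwarz for the residual bounds (‖a‖ + ‖b‖)² by
  -- 1.
  have hCS := norm_inner_le_norm (𝕜 := ℂ) (theta r) r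
  rw [hQ, norm_theta, norm_neg, norm_mul, norm_mul, Complex.norm_two] at hCS
  have hab : ‖a‖ + ‖b‖ ≤ 1 := by
    have : (‖a‖ + ‖b‖) ^ 2 ≤ 1 ^ 2 := by nlinarith
    exact (pow_le_pow_iff_left₀ (by positivity) zero_le_one two_ne_zero).mp this
  have hst : √(1 - f) ≤ √f := Real.sqrt_le_sqrt (by linarith [h.weight.1])
  have hle : ‖⟪χ, Ψ⟫_ℂ‖ ≤ √f := by
    rw [h.eq, inner_smul_right, inner_add_right, inner_smul_right, inner_smul_right, hca, hcb,
      norm_mul, mul_comm Complex.I, Complex.norm_exp_ofReal_mul_I, one_mul]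
    refine (norm_add_le _ _).trans ?_
    rw [norm_mul, norm_mul, RCLike.norm_conj, RCLike.norm_conj, Complex.norm_real,
      Complex.norm_real, Real.norm_of_nonneg (Real.sqrt_nonneg _),
      Real.norm_of_nonneg (Real.sqrt_nonneg _)]
    have hs0 := Real.sqrt_nonneg f
    nlinarith [norm_nonneg a, norm_nonneg b, mul_le_mul_of_nonneg_right hst (norm_nonneg b)]
  calc ‖⟪χ, Ψ⟫_ℂ‖ ^ 2 ≤ √f ^ 2 := pow_le_pow_left₀ (norm_nonneg _) hle 2
    _ = f := Real.sq_sqrt (by linarith [h.weight.1])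

lemma norm_inner_sq (h : IsGaussianDecomposition Ψ f φ g) : ‖⟪g, Ψ⟫_ℂ‖ ^ 2 = f := by
  have h1 := inner_theta_of_mem_posGaussianStates h.gaussian
  have h2 : ⟪g, theta g⟫_ℂ = 0 := by rw [← inner_conj_symm, h1, map_zero]
  have h3 := inner_self_of_norm_eq_one h.norm_eq_one
  rw [h.eq, inner_smul_right, inner_add_right, inner_smul_right, inner_smul_right, h2, h3,
    mul_zero, add_zero, mul_one, norm_mul, mul_comm Complex.I, Complex.norm_exp_ofReal_mul_I,
    one_mul, Complex.norm_real, Real.norm_of_nonneg (Real.sqrt_nonneg _),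
    Real.sq_sqrt (by linarith [h.weight.1])]

lemma fidelity_eq (h : IsGaussianDecomposition Ψ f φ g) :
    fidelity (posGaussianStates 4) Ψ = f := by
  refine IsGreatest.csSup_eq ⟨⟨g, h.gaussian, h.norm_inner_sq⟩, ?_⟩
  rintro _ ⟨χ, hχ, rfl⟩
  exact h.norm_inner_sq_le hχ

end IsGaussianDecomposition

lemma exists_isGaussianDecomposition {Ψ : H 4} (hpar : Ψ ∈ posParity 4) (hnorm : ‖Ψ‖ = 1) :
    ∃ f φ g, IsGaussianDecomposition Ψ f φ g := by
  obtain ⟨φ, hφ, hz⟩ := exists_phase ⟪theta Ψ, Ψ⟫_ℂ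
  have he : Complex.exp (Complex.I * φ) ≠ 0 := Complex.exp_ne_zero _
  have hn : ‖Complex.exp (Complex.I * φ)‖ = 1 := by
    rw [mul_comm, Complex.norm_exp_ofReal_mul_I]
  set e := Complex.exp (Complex.I * φ)
  have hce : conj e⁻¹ = e := by
    rw [map_inv₀, inv_eq_iff_eq_inv, Complex.inv_def, Complex.normSq_eq_norm_sq, hn]; simp
  have hQ : ⟪theta (e⁻¹ • Ψ), e⁻¹ • Ψ⟫_ℂ = (‖⟪theta Ψ, Ψ⟫_ℂ‖ : ℝ) := by
    rw [theta_smul, inner_smul_left, inner_smul_right, Complex.conj_conj]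
    conv_lhs => rw [hz]
    field_simp
  obtain ⟨f, hf, g, hg, h⟩ := exists_gaussian_decomposition (smul_mem_posParity hpar e⁻¹)
    (by rw [norm_smul, norm_inv, hn, hnorm]; simp) (norm_nonneg _) hQ
  refine ⟨f, φ, g, hg, hφ, hf, ?_⟩
  rw [← h, smul_smul, mul_inv_cancel₀ he, one_smul]

end Fermion

end

/-- For a positive-parity 4-mode unit vector `Ψ`, the decomposition
`Ψ = e^{iφ} (√f Ψ_g + √(1-f) θ Ψ_g)` exists, its weight `f` is determined by `Ψ` (as is, if
`f > 1/2`, the component `e^{iφ} Ψ_g`, and, if `1/2 < f < 1`, the pair `(φ, Ψ_g)` up to a common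
sign), and the Gaussian fidelity of `Ψ` is `f`. -/
theorem mainTheorem7 (Ψ : Fermion.H 4) (hpar : Ψ ∈ Fermion.posParity 4) (hnorm : ‖Ψ‖ = 1) :
    ∃ f ∈ Set.Icc (1 / 2 : ℝ) 1,
      (∃ (φ : ℝ) (Ψg : Fermion.H 4), Fermion.IsGaussianDecomposition Ψ f φ Ψg ∧
        Fermion.theta Ψg ∈ Fermion.posGaussianStates 4 ∧
        inner ℂ Ψg (Fermion.theta Ψg) = 0) ∧
      (∀ (f' φ' : ℝ) (Ψg' : Fermion.H 4),
        Fermion.IsGaussianDecomposition Ψ f' φ' Ψg' → f' = f) ∧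
      (1 / 2 < f → ∀ (φ φ' : ℝ) (Ψg Ψg' : Fermion.H 4),
        Fermion.IsGaussianDecomposition Ψ f φ Ψg →
        Fermion.IsGaussianDecomposition Ψ f φ' Ψg' →
        Complex.exp (Complex.I * φ) • Ψg = Complex.exp (Complex.I * φ') • Ψg' ∧
        (f < 1 → (φ' = φ ∧ Ψg' = Ψg) ∨
          (Complex.exp (Complex.I * φ') = -Complex.exp (Complex.I * φ) ∧ Ψg' = -Ψg))) ∧
      Fermion.fidelity (Fermion.posGaussianStates 4) Ψ = f := by

  obtain ⟨f, φ, g, h⟩ := Fermion.exists_isGaussianDecomposition hpar hnorm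
  refine ⟨f, h.weight, ⟨φ, g, h, Fermion.theta_mem_posGaussianStates h.gaussian, ?_⟩,
    fun f' φ' g' h' => h.weight_unique h', fun hf φ₁ φ₂ g₁ g₂ h₁ h₂ =>
      ⟨h₁.component_unique hf h₂, fun hf1 => h₁.pair_unique hf hf1 h₂⟩, h.fidelity_eq⟩
  rw [← inner_conj_symm, Fermion.inner_theta_of_mem_posGaussianStates h.gaussian, map_zero]
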